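/- Let $\beta>1$ be a non-simple Parry number: the Rényi expansion of unity $d_\beta(1)=t_1t_2t_3\cdots$, $t_i=\lfloor\beta\,T_\beta^{i-1}(1)\rfloor$ with $T_\beta(x)=\{\beta x\}$, has infinitely many nonzero digits and is eventually periodic, $d_\beta(1)=t_1\cdots t_m(t_{m+1}\cdots t_{m+p})^\omega$ with $m,p>0$ least possible. Let $\varphi$ be the substitution on $\mathcal A=\{0,\dots,m+p-1\}$ given by $\varphi(k)=0^{t_{k+1}}(k+1)$ for $k<m+p-1$ and $\varphi(m+p-1)=0^{t_{m+p}}m$, and let $u_\beta=\lim_n\varphi^n(0)$. For a finite word $v$ let $\mathrm{Lext}(v)$ (resp. $\mathrm{Rext}(v)$) be the set of letters $a$ such that $av$ (resp. $va$) is a factor of $u_\beta$. For distinct $a,b\in\mathrm{Lext}(v)$, the word $v$ is an $(a,b)$-maximal left special factor if $\mathrm{Rext}(av)\cap\mathrm{Rext}(bv)=\emptyset$. For distinct letters $a,b$ let $f_L(a,b)$ (resp. $f_R(a,b)$) be the longest common suffix (resp. prefix) of $\varphi(a)$ and $\varphi(b)$. Let $g_L(a,b)$ be the set of the last letters of $\varphi(a)f_L(a,b)^{-1}$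 and $\varphi(b)f_L(a,b)^{-1}$ if $f_L(a,b)$ is a proper suffix of both $\varphi(a)$ and $\varphi(b)$; if $f_L(a,b)=\varphi(a)$, let $g_L(a,b)$ consist of the last letter of $\varphi(b)f_L(a,b)^{-1}$ and of the last letters of all $\varphi(c)$ with $c\in\mathrm{Lext}(a)$ and $\mathrm{Rext}(ca)\cap\mathrm{Rext}(b)\neq\emptyset$ (and symmetrically if $f_L(a,b)=\varphi(b)$). The max-$f$-image of a factor $v$ with distinct left extensions $a,b$ is $f_L(a,b)\varphi(v)f_R(c,d)$, where $c\in\mathrm{Rext}(av)$, $d\in\mathrm{Rext}(bv)$, $c\ne d$, are such that both $t_{c+1}$ and $t_{d+1}$ are at least $\max\{\min(t_{e+1},t_{f+1}) : e\in\mathrm{Rext}(av),\ f\in\mathrm{Rext}(bv),\ e\neq f\}$; it is considered with the two left extensions forming $g_L(a,b)$. The $k$-th max-$f$-image is obtained by $k$ successive steps of this kind. Let $v$ be an $(a,b)$-maximal left special factor of $u_\beta$. Put $w=0^{t_1-1}$ if $t_1>1$, and $w=0$ if $t_1=1$; in the case $t_1=1$ assume moreover that $m\ge 2$ and that $v$ is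 not the empty word. Then there are $k\in\mathbb N$ and distinct left extensions $a_0,b_0$ of $w$ such that $g_L^k(a_0,b_0)=\{a,b\}$ and $v$ is the $k$-th max-$f$-image of $w$ with left extensions $a_0,b_0$. Moreover, $k,a_0,b_0$ can be chosen such that also $$v=s\,\varphi^k(w)\,\mathrm{lcp}\bigl(\varphi^k(c),\varphi^k(d)\bigr),\qquad s=f_L(g_L^{k-1}(a_0,b_0))\cdots\varphi^{k-2}(f_L(g_L(a_0,b_0)))\,\varphi^{k-1}(f_L(a_0,b_0)),$$ where $\mathrm{lcp}$ is the longest common prefix and $c\in\mathrm{Rext}(a_0w)$, $d\in\mathrm{Rext}(b_0w)$ are the (distinct) letters for which the sequences $t_{c+1}t_{c+2}\cdots$ and $t_{d+1}t_{d+2}\cdots$ are lexicographically greatest. -/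

import Mathlib

namespace ParryWord

/-! Combinatorics on words over an arbitrary alphabet. -/

section Words

variable {α : Type*}

/-- `v` is a (finite) factor of the infinite word `u`. -/
def IsFactor (u : ℕ → α) (v : List α) : Prop :=
  ∃ j : ℕ, v = (List.range v.length).map fun i => u (j + i)

/-- The set of left extensions of `v`. -/
def lext (u : ℕ → α) (v : List α) : Set α := {a | IsFactor u (a :: v)}

/-- The set of right extensions of `v`. -/
def rext (u : ℕ → α) (v : List α) : Set α := {c | IsFactor u (v ++ [c])}

/-- `v` is an `(a, b)`-maximal left special factor of `u`. -/
def IsMaximalLS (u : ℕ → α) (a b : α) (v : List α) : Prop :=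
  a ≠ b ∧ a ∈ lext u v ∧ b ∈ lext u v ∧ rext u (a :: v) ∩ rext u (b :: v) = ∅

variable [DecidableEq α]

/-- The longest common prefix of two finite words. -/
def lcp : List α → List α → List α
  | x :: xs, y :: ys => if x = y then x :: lcp xs ys else []
  | _, _ => []

/-- The longest common suffix of two finite words. -/
def lcs (v w : List α) : List α := (lcp v.reverse w.reverse).reverse

/-- The extension of a substitution, given on letters, to finite words. -/
def applySubst (φ : α → List α) (w : List α) : List α := w.flatMap φ

/-- `f_L(a, b)`: the longest common suffix of `φ(a)` and `φ(b)`. -/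
def fL (φ : α → List α) (a b : α) : List α := lcs (φ a) (φ b)

/-- `f_R(c, d)`: the longest common prefix of `φ(c)` and `φ(d)`. -/
def fR (φ : α → List α) (c d : α) : List α := lcp (φ c) (φ d)

/-- The set `g_L(a, b)` in the case where `φ(a)` is a suffix of `φ(b)`: the last letter of
`φ(b) φ(a)⁻¹` together with the last letters of all `φ(c)`, where `c` is a left extension of `a`
such that `c a` and `b` have a common right extension. -/
def gLSuffix (φ : α → List α) (u : ℕ → α) (a b : α) : Set α :=
  {x | x ∈ ((φ b).rdrop (φ a).length).getLast?} ∪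
    {x | ∃ c ∈ lext u [a], (rext u [c, a] ∩ rext u [b]).Nonempty ∧ x ∈ (φ c).getLast?}

/-- The set `g_L(a, b)`. If `f_L(a, b)` is a proper suffix of both images, it consists of the last
letters of `φ(a) f_L(a, b)⁻¹` and `φ(b) f_L(a, b)⁻¹`. -/
def gL (φ : α → List α) (u : ℕ → α) (a b : α) : Set α :=
  if fL φ a b = φ a then gLSuffix φ u a b
  else if fL φ a b = φ b then gLSuffix φ u b a
  else {x | x ∈ ((φ a).rdrop (fL φ a b).length).getLast? ∨
            x ∈ ((φ b).rdrop (fL φ a b).length).getLast?}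

end Words

/-! Non-simple Parry numbers and their words. -/

noncomputable section

/-- The map `T_β(x) = {β x}`. -/
def betaMap (β x : ℝ) : ℝ := Int.fract (β * x)

/-- The digits of the Rényi expansion of unity `d_β(1) = t₁ t₂ t₃ ⋯`, indexed from zero:
`digit β k` is `t_{k+1} = ⌊β T_β^k(1)⌋`. -/
def digit (β : ℝ) (k : ℕ) : ℕ := ⌊β * (betaMap β)^[k] 1⌋₊

/-- `d_β(1) = t₁ ⋯ t_m (t_{m+1} ⋯ t_{m+p})^ω`. -/
def HasExpansionShape (β : ℝ) (m p : ℕ) : Prop :=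
  ∀ i, m ≤ i → digit β (i + p) = digit β i

/-- `β > 1` is a non-simple Parry number, and `d_β(1) = t₁ ⋯ t_m (t_{m+1} ⋯ t_{m+p})^ω` with
`m, p > 0` the least possible. -/
structure IsNonSimpleParry (β : ℝ) (m p : ℕ) : Prop where
  one_lt : 1 < β
  not_finite : ∀ N, ∃ n, N ≤ n ∧ digit β n ≠ 0
  m_pos : 0 < m
  p_pos : 0 < p
  shape : HasExpansionShape β m p
  least : ∀ m' p', 0 < m' → 0 < p' → HasExpansionShape β m' p' → m ≤ m' ∧ p ≤ p'

/-- The canonical substitution on the alphabet `{0, …, m + p - 1}`: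
`k ↦ 0^{t_{k+1}} (k+1)` for `k < m + p - 1`, and `m + p - 1 ↦ 0^{t_{m+p}} m`.
(Letters are natural numbers; the values for `k ≥ m + p` are irrelevant.) -/
def phi (β : ℝ) (m p : ℕ) (k : ℕ) : List ℕ :=
  List.replicate (digit β k) 0 ++ [if k + 1 < m + p then k + 1 else m]

/-- The word `φ_β^n(w)`. -/
def phiIter (β : ℝ) (m p : ℕ) (n : ℕ) (w : List ℕ) : List ℕ :=
  (applySubst (phi β m p))^[n] w

/-- The fixed point `u_β = lim φ_β^n(0)`: as `φ_β^n(0)` is a prefix of `φ_β^{n+1}(0)` and has more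
than `n` letters, the letter of `u_β` at (zero-based) position `n` is the one of `φ_β^n(0)`. -/
def uBeta (β : ℝ) (m p : ℕ) (n : ℕ) : ℕ := (phiIter β m p n [0]).getD n 0

/-- `w` is the max-`f`-image of the factor `v` with left extensions `a` and `b`: the word
`f_L(a,b) φ_β(v) f_R(c,d)`, where `c ≠ d` are right extensions of `av` and of `bv` for which
`t_{c⊕1}` and `t_{d⊕1}` are both at least
`max {min(t_{e⊕1}, t_{f⊕1}) | e ∈ Rext(av), f ∈ Rext(bv), e ≠ f}`. -/
def IsMaxFImage (β : ℝ) (m p : ℕ) (a b : ℕ) (v w : List ℕ) : Prop :=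
  ∃ c ∈ rext (uBeta β m p) (a :: v), ∃ d ∈ rext (uBeta β m p) (b :: v), c ≠ d ∧
    (∀ e ∈ rext (uBeta β m p) (a :: v), ∀ f ∈ rext (uBeta β m p) (b :: v), e ≠ f →
      min (digit β e) (digit β f) ≤ digit β c ∧ min (digit β e) (digit β f) ≤ digit β d) ∧
    w = fL (phi β m p) a b ++ applySubst (phi β m p) v ++ fR (phi β m p) c d

/-- `IsIterMaxFImage β m p a₀ b₀ v₀ k a b v`: `v` is the `k`-th max-`f`-image of the factor `v₀`
with left extensions `a₀, b₀`, and `{a, b} = g_L^k(a₀, b₀)` are the corresponding left extensions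
of `v`. -/
inductive IsIterMaxFImage (β : ℝ) (m p : ℕ) (a₀ b₀ : ℕ) (v₀ : List ℕ) :
    ℕ → ℕ → ℕ → List ℕ → Prop
  | zero : IsIterMaxFImage β m p a₀ b₀ v₀ 0 a₀ b₀ v₀
  | succ {k a b a' b' : ℕ} {v v' : List ℕ} :
      IsIterMaxFImage β m p a₀ b₀ v₀ k a b v →
      gL (phi β m p) (uBeta β m p) a b = {a', b'} →
      IsMaxFImage β m p a b v v' →
      IsIterMaxFImage β m p a₀ b₀ v₀ (k + 1) a' b' v'

/-- `IsIterPrefix β m p a₀ b₀ k a b s`: `{a, b} = g_L^k(a₀, b₀)` and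
`s = f_L(g_L^{k-1}(a₀,b₀)) ⋯ φ_β^{k-2}(f_L(g_L(a₀,b₀))) φ_β^{k-1}(f_L(a₀,b₀))`. -/
inductive IsIterPrefix (β : ℝ) (m p : ℕ) (a₀ b₀ : ℕ) : ℕ → ℕ → ℕ → List ℕ → Prop
  | zero : IsIterPrefix β m p a₀ b₀ 0 a₀ b₀ []
  | succ {k a b a' b' : ℕ} {s : List ℕ} :
      IsIterPrefix β m p a₀ b₀ k a b s →
      gL (phi β m p) (uBeta β m p) a b = {a', b'} →
      IsIterPrefix β m p a₀ b₀ (k + 1) a' b'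
        (fL (phi β m p) a b ++ applySubst (phi β m p) s)

/-- `c` is the right extension of `v` for which `t_{c⊕1} t_{c⊕2} ⋯` is lexicographically
greatest. -/
def IsLexGreatestRext (β : ℝ) (m p : ℕ) (v : List ℕ) (c : ℕ) : Prop :=
  c ∈ rext (uBeta β m p) v ∧ ∀ c' ∈ rext (uBeta β m p) v,
    toLex (fun i => digit β (c' + i)) ≤ toLex (fun i => digit β (c + i))

/-- `v`, with its left extensions `a, b`, is for some `k` the `k`-th max-`f`-image of the factor
`g` with some distinct left extensions `a₀, b₀`, and has the explicit form
`v = s φ_β^k(g) lcp(φ_β^k(c), φ_β^k(d))`. -/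
def IsGeneratedBy (β : ℝ) (m p : ℕ) (g : List ℕ) (a b : ℕ) (v : List ℕ) : Prop :=
  ∃ k a₀ b₀ : ℕ, a₀ ≠ b₀ ∧ a₀ ∈ lext (uBeta β m p) g ∧ b₀ ∈ lext (uBeta β m p) g ∧
    IsIterMaxFImage β m p a₀ b₀ g k a b v ∧
    ∃ (s : List ℕ) (c d : ℕ), IsIterPrefix β m p a₀ b₀ k a b s ∧
      IsLexGreatestRext β m p (a₀ :: g) c ∧ IsLexGreatestRext β m p (b₀ :: g) d ∧ c ≠ d ∧
      v = s ++ phiIter β m p k g ++ lcp (phiIter β m p k [c]) (phiIter β m p k [d])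

end

end ParryWord

/-! Order the letters by their digit sequences: `key β c` is the tail of the expansion of unity
starting at `digit β c`. The letter 0 is the unique greatest one, and minimality of `m` and `p`
makes `key` injective on the alphabet. The substitution respects this order (`key_le_of_phi_eq`): if
φ(c) and φ(d) share a prefix of zeros and c is below d, the letters that follow compare the same
way. Greatest right extensions therefore pass to greatest right extensions under φ.

Maximality enters only through a weaker property, `IsLexSplit`: the greatest right extensions of
`av` and `bv` differ. Unlike disjointness of the extension sets, this property is inherited by
preimages. A word with this property that contains a nonzero letter desubstitutes uniquely to a
nonempty word with the same property (`exists_isLexPreimage`). The delicate case is that of two left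
letters a', b' among m-1 and m+p-1, where φ(a') is a proper suffix of φ(b'): then a' has only one
left extension (`left_letter_unique`), so g_L(a', b') is a genuine pair, and `pred_zero_mem` keeps
the preimage nonempty.

Each preimage has smaller weight (`exists_wordWeight`), so the descent stops at a nonempty word of
zeros. The only such word is the stated generator, because all shorter and all longer zero runs have
a common greatest right extension. The explicit formula is carried along the descent. -/

namespace ParryWord

/-! ### Lexicographic order on the tails of the expansion of unity. -/

section Digits

variable {β : ℝ} {m p : ℕ}

/-- The digit sequence `t_{c+1} t_{c+2} ⋯` as an element of the lexicographic order. -/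
noncomputable def key (β : ℝ) (c : ℕ) : Lex (ℕ → ℕ) := toLex fun i => digit β (c + i)

theorem betaMap_iterate_nonneg (β : ℝ) (n : ℕ) : 0 ≤ (betaMap β)^[n] 1 := by
  cases n with
  | zero => simp
  | succ n => rw [Function.iterate_succ_apply']; exact Int.fract_nonneg _

theorem betaMap_iterate_lt_one (β : ℝ) (n : ℕ) : (betaMap β)^[n + 1] 1 < 1 := by
  rw [Function.iterate_succ_apply']; exact Int.fract_lt_one _

theorem betaMap_iterate_le_one (β : ℝ) (n : ℕ) : (betaMap β)^[n] 1 ≤ 1 := by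
  cases n with
  | zero => simp
  | succ n => exact (betaMap_iterate_lt_one β n).le

theorem betaMap_iterate_succ (hβ : 1 < β) (n : ℕ) :
    (betaMap β)^[n + 1] 1 = β * (betaMap β)^[n] 1 - digit β n := by
  have h0 : 0 ≤ β * (betaMap β)^[n] 1 :=
    mul_nonneg (by linarith) (betaMap_iterate_nonneg β n)
  rw [Function.iterate_succ_apply', digit, natCast_floor_eq_intCast_floor h0]
  rfl

/-- As long as the digits agree, both orbits undergo the same affine map of slope β. -/
theorem betaMap_iterate_sub (hβ : 1 < β) {c d n : ℕ}
    (h : ∀ i < n, digit β (c + i) = digit β (d + i)) :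
    (betaMap β)^[c + n] 1 - (betaMap β)^[d + n] 1 =
      β ^ n * ((betaMap β)^[c] 1 - (betaMap β)^[d] 1) := by
  induction n with
  | zero => simp
  | succ n ih =>
    have h1 := ih fun i hi => h i (by omega)
    have h2 := h n (by omega)
    rw [← add_assoc, ← add_assoc, betaMap_iterate_succ hβ, betaMap_iterate_succ hβ, h2, pow_succ]
    linear_combination β * h1

/-- A nonzero difference would grow like `β ^ n`, although both orbits stay in [0, 1]. -/
theorem betaMap_iterate_eq_of_key_eq (hβ : 1 < β) {c d : ℕ} (h : key β c = key β d) :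
    (betaMap β)^[c] 1 = (betaMap β)^[d] 1 := by
  have h' : ∀ i, digit β (c + i) = digit β (d + i) := fun i => congrFun (toLex.injective h) i
  by_contra hne
  have hpos : 0 < |(betaMap β)^[c] 1 - (betaMap β)^[d] 1| := abs_pos.2 (sub_ne_zero.2 hne)
  obtain ⟨n, hn⟩ := pow_unbounded_of_one_lt (1 / |(betaMap β)^[c] 1 - (betaMap β)^[d] 1|) hβ
  rw [div_lt_iff₀ hpos] at hn
  have h1 := congrArg abs (betaMap_iterate_sub hβ (n := n) fun i _ => h' i)
  rw [abs_mul, abs_of_pos (pow_pos (by linarith : (0 : ℝ) < β) n)] at h1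
  have h2 : |(betaMap β)^[c + n] 1 - (betaMap β)^[d + n] 1| ≤ 1 := by
    have := betaMap_iterate_nonneg β (c + n)
    have := betaMap_iterate_nonneg β (d + n)
    have := betaMap_iterate_le_one β (c + n)
    have := betaMap_iterate_le_one β (d + n)
    rw [abs_le]; constructor <;> linarith
  linarith

/-- The orbit starts at 1, its largest value, and this advantage is preserved until the first
differing digit. -/
theorem key_le_key_zero (hβ : 1 < β) (c : ℕ) : key β c ≤ key β 0 := by
  by_contra h
  rw [not_le] at h
  obtain ⟨n, h1, h2⟩ := h
  have h1' : ∀ i < n, digit β (0 + i) = digit β (c + i) := h1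
  have h2' : digit β (0 + n) < digit β (c + n) := h2
  have h3 := betaMap_iterate_sub hβ h1'
  have h4 : (betaMap β)^[c + n] 1 ≤ (betaMap β)^[0 + n] 1 := by
    have : 0 ≤ β ^ n * ((betaMap β)^[0] 1 - (betaMap β)^[c] 1) :=
      mul_nonneg (pow_nonneg (by linarith) n)
        (by have := betaMap_iterate_le_one β c; simpa using this)
    linarith
  exact absurd h2' (not_lt.2 (Nat.floor_le_floor (mul_le_mul_of_nonneg_left h4 (by linarith))))

theorem key_lt_key_zero (hβ : 1 < β) {c : ℕ} (hc : 0 < c) : key β c < key β 0 := by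
  refine lt_of_le_of_ne (key_le_key_zero hβ c) fun h => ?_
  have h1 := betaMap_iterate_eq_of_key_eq hβ h
  obtain ⟨c, rfl⟩ := Nat.exists_eq_succ_of_ne_zero hc.ne'
  exact absurd h1 (betaMap_iterate_lt_one β c).ne

theorem digit_le_of_key_le {c d : ℕ} (h : key β c ≤ key β d) : digit β c ≤ digit β d := by
  rcases h.lt_or_eq with h | h
  · obtain ⟨n, h1, h2⟩ := h
    rcases Nat.eq_zero_or_pos n with rfl | hn
    · exact le_of_lt h2
    · exact (h1 0 hn).le
  · exact (congrFun (toLex.injective h) 0).le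

theorem key_succ_le_of_key_le {c d : ℕ} (h : key β c ≤ key β d) (hd : digit β c = digit β d) :
    key β (c + 1) ≤ key β (d + 1) := by
  rcases h.lt_or_eq with h | h
  · obtain ⟨n, h1, h2⟩ := h
    rcases n with - | n
    · exact absurd hd (ne_of_lt h2)
    · refine le_of_lt ⟨n, fun i hi => ?_, ?_⟩
      · have : digit β (c + (i + 1)) = digit β (d + (i + 1)) := h1 (i + 1) (by omega)
        change digit β (c + 1 + i) = digit β (d + 1 + i)
        rwa [add_assoc, add_assoc, add_comm 1]
      · have : digit β (c + (n + 1)) < digit β (d + (n + 1)) := h2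
        change digit β (c + 1 + n) < digit β (d + 1 + n)
        rwa [add_assoc, add_assoc, add_comm 1]
  · refine le_of_eq (congrArg toLex (funext fun i => ?_))
    have : digit β (c + (i + 1)) = digit β (d + (i + 1)) := congrFun (toLex.injective h) (i + 1)
    rwa [add_assoc, add_assoc, add_comm 1]

namespace IsNonSimpleParry

theorem digit_le (hβ : IsNonSimpleParry β m p) (c : ℕ) : digit β c ≤ digit β 0 :=
  digit_le_of_key_le (key_le_key_zero hβ.one_lt c)

theorem digit_zero_pos (hβ : IsNonSimpleParry β m p) : 0 < digit β 0 := by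
  simp only [digit, Function.iterate_zero, id, mul_one]
  exact Nat.floor_pos.2 hβ.one_lt.le

/-- Equal tails at 0 < c < d make `d - c` a period from c on, so minimality gives m ≤ c and p ≤ d -
c, pushing d out of the alphabet. The minimality hypothesis needs c positive; c = 0 is excluded by
strictness. -/
theorem key_injOn (hβ : IsNonSimpleParry β m p) {c d : ℕ} (hc : c < m + p) (hd : d < m + p)
    (h : key β c = key β d) : c = d := by
  wlog hcd : c ≤ d generalizing c d
  · exact (this hd hc h.symm (by omega)).symm
  by_contra hne
  rcases Nat.eq_zero_or_pos c with rfl | hc0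
  · exact (key_lt_key_zero hβ.one_lt (by omega)).ne h.symm
  · have h' : ∀ i, digit β (c + i) = digit β (d + i) := fun i => congrFun (toLex.injective h) i
    have := hβ.least c (d - c) hc0 (by omega) fun i hi => by
      have := h' (i - c)
      rw [show c + (i - c) = i by omega, show d + (i - c) = i + (d - c) by omega] at this
      exact this.symm
    omega

theorem key_add (hβ : IsNonSimpleParry β m p) : key β (m + p) = key β m :=
  congrArg toLex (funext fun i => by
    have := hβ.shape (m + i) (by omega)
    rwa [show m + i + p = m + p + i by omega] at this)

theorem digit_pred_ne (hβ : IsNonSimpleParry β m p) : digit β (m - 1) ≠ digit β (m + p - 1) := by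
  intro h
  have hm := hβ.m_pos
  have hp := hβ.p_pos
  have : m - 1 = m + p - 1 := by
    refine hβ.key_injOn (by omega) (by omega) (congrArg toLex (funext fun i => ?_))
    rcases i with - | i
    · exact h
    · have := hβ.shape (m + i) (by omega)
      rw [show m - 1 + (i + 1) = m + i by omega, show m + p - 1 + (i + 1) = m + i + p by omega]
      exact this.symm
  omega

/-- If `t₁ = 1` and `m ≥ 2`, one of the digits `t₂, …, t_m` is nonzero. -/
theorem exists_digit_pos (hβ : IsNonSimpleParry β m p) (h1 : digit β 0 = 1) (hm : 2 ≤ m) :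
    ∃ r, 0 < r ∧ r < m ∧ 0 < digit β r := by
  by_contra! hz
  have hp := hβ.p_pos
  have hz' : ∀ r, 0 < r → r < m → digit β r = 0 := fun r h h' => Nat.le_zero.1 (hz r h h')
  have hlast : digit β (m + p - 1) = 1 := by
    have h2 := hβ.digit_pred_ne
    have h3 := hβ.digit_le (m + p - 1)
    rw [hz' (m - 1) (by omega) (by omega)] at h2
    omega
  have hex : ∃ r, 0 < r ∧ digit β r ≠ 0 := by
    obtain ⟨n, h2, h3⟩ := hβ.not_finite 1
    exact ⟨n, h2, h3⟩
  classical
  obtain ⟨hr0, hr1⟩ := Nat.find_spec hex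
  have hmin : ∀ r < Nat.find hex, 0 < r → digit β r = 0 := fun r hr hr' => by
    by_contra h; exact Nat.find_min hex hr ⟨hr', h⟩
  set r := Nat.find hex with hr
  have hmr : m ≤ r := by
    by_contra h
    exact hr1 (hz' r hr0 (by omega))
  -- The tail from `m + p - 1` also starts with 1 followed by zeros, but meets the first nonzero
  -- digit `r` already at offset `r + 1 - m < r`, so it would exceed the whole expansion.
  refine absurd (key_le_key_zero hβ.one_lt (m + p - 1)) (not_le.2 ⟨r + 1 - m, ?_, ?_⟩)
  · intro i hi
    change digit β (0 + i) = digit β (m + p - 1 + i)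
    rcases i with - | i
    · simp [h1, hlast]
    · rw [zero_add, hmin (i + 1) (by omega) (by omega),
        show m + p - 1 + (i + 1) = m + i + p by omega, hβ.shape _ (by omega),
        hmin _ (by omega) (by omega)]
  · change digit β (0 + (r + 1 - m)) < digit β (m + p - 1 + (r + 1 - m))
    rw [zero_add, hmin _ (by omega) (by omega),
      show m + p - 1 + (r + 1 - m) = r + p by omega, hβ.shape _ hmr]
    omega

end IsNonSimpleParry

end Digits

end ParryWord

namespace ParryWord

/-! ### The substitution, its injectivity, and the language of its fixed point. -/

section Substitution

variable {β : ℝ} {m p : ℕ}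

/-- The last letter of `φ_β(k)`. -/
def succLetter (m p k : ℕ) : ℕ := if k + 1 < m + p then k + 1 else m

theorem phi_eq (β : ℝ) (m p k : ℕ) :
    phi β m p k = List.replicate (digit β k) 0 ++ [succLetter m p k] := rfl

theorem succLetter_of_lt {k : ℕ} (h : k + 1 < m + p) : succLetter m p k = k + 1 := if_pos h

theorem succLetter_pos (hm : 0 < m) (k : ℕ) : succLetter m p k ≠ 0 := by
  unfold succLetter; split_ifs <;> omega

theorem succLetter_lt (hp : 0 < p) (k : ℕ) : succLetter m p k < m + p := by
  unfold succLetter; split_ifs <;> omega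

theorem eq_or_of_succLetter_eq {c d : ℕ} (hc : c < m + p) (hd : d < m + p)
    (h : succLetter m p c = succLetter m p d) :
    c = d ∨ (c = m - 1 ∧ d = m + p - 1) ∨ (c = m + p - 1 ∧ d = m - 1) := by
  unfold succLetter at h; split_ifs at h <;> omega

theorem IsNonSimpleParry.key_succLetter (hβ : IsNonSimpleParry β m p) {c : ℕ} (hc : c < m + p) :
    key β (succLetter m p c) = key β (c + 1) := by
  unfold succLetter
  split_ifs with h
  · rfl
  · rw [show c + 1 = m + p by omega, hβ.key_add]

theorem eq_of_succLetter_eq_succ {d k : ℕ} (h : k + 1 = succLetter m p d) (hk : k + 1 ≠ m) :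
    d = k := by
  unfold succLetter at h
  split_ifs at h
  · exact (Nat.succ.inj h).symm
  · exact absurd h hk

theorem eq_or_of_succLetter_eq_self {d : ℕ} (hd : d < m + p) (h : m = succLetter m p d) :
    d = m - 1 ∨ d = m + p - 1 := by
  rcases lt_or_ge (d + 1) (m + p) with h1 | h1
  · rw [succLetter_of_lt h1] at h; omega
  · omega

theorem replicate_append_cons_inj {α : Type*} {z a b : α} (ha : a ≠ z) (hb : b ≠ z) {i j : ℕ}
    {x y : List α} (h : List.replicate i z ++ a :: x = List.replicate j z ++ b :: y) :
    i = j ∧ a = b ∧ x = y := by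
  induction i generalizing j with
  | zero =>
    cases j with
    | zero => simpa using h
    | succ j => simp [List.replicate_succ] at h; exact absurd h.1 ha
  | succ i ih =>
    cases j with
    | zero => simp [List.replicate_succ] at h; exact absurd h.1.symm hb
    | succ j =>
      simp only [List.replicate_succ, List.cons_append, List.cons.injEq, true_and] at h
      obtain ⟨h1, h2⟩ := ih h
      exact ⟨by omega, h2⟩

@[simp] theorem applySubst_nil {α : Type*} (φ : α → List α) : applySubst φ [] = [] := rfl

@[simp] theorem applySubst_cons {α : Type*} (φ : α → List α) (a : α) (w : List α) :
    applySubst φ (a :: w) = φ a ++ applySubst φ w := by simp [applySubst]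

@[simp] theorem applySubst_append {α : Type*} (φ : α → List α) (v w : List α) :
    applySubst φ (v ++ w) = applySubst φ v ++ applySubst φ w := by simp [applySubst]

/-- An image ends at its first nonzero letter. Only m is the last letter of two images, and these
have different numbers of zeros by `digit_pred_ne`. -/
theorem IsNonSimpleParry.phi_append_inj (hβ : IsNonSimpleParry β m p) {c d : ℕ}
    (hc : c < m + p) (hd : d < m + p) {x y : List ℕ}
    (h : phi β m p c ++ x = phi β m p d ++ y) : c = d ∧ x = y := by
  simp only [phi_eq, List.append_assoc, List.singleton_append] at h
  obtain ⟨h1, h2, h3⟩ := replicate_append_cons_inj (succLetter_pos hβ.m_pos c)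
    (succLetter_pos hβ.m_pos d) h
  refine ⟨?_, h3⟩
  have := hβ.digit_pred_ne
  rcases eq_or_of_succLetter_eq hc hd h2 with h | ⟨rfl, rfl⟩ | ⟨rfl, rfl⟩
  · exact h
  · exact absurd h1 this
  · exact absurd h1.symm this

theorem IsNonSimpleParry.applySubst_append_zeros_inj (hβ : IsNonSimpleParry β m p)
    {X Y : List ℕ} (hX : ∀ x ∈ X, x < m + p) (hY : ∀ x ∈ Y, x < m + p) {i j : ℕ}
    (h : applySubst (phi β m p) X ++ List.replicate i 0 =
      applySubst (phi β m p) Y ++ List.replicate j 0) : X = Y ∧ i = j := by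
  have hno : ∀ (c : ℕ) (Z : List ℕ) (n k : ℕ),
      List.replicate n 0 ≠ phi β m p c ++ Z ++ List.replicate k 0 := fun c Z n k h => by
    have : succLetter m p c ∈ List.replicate n 0 := by rw [h]; simp [phi_eq]
    exact succLetter_pos hβ.m_pos c (List.eq_of_mem_replicate this)
  induction X generalizing Y with
  | nil =>
    cases Y with
    | nil => simpa using h
    | cons d Y => exact absurd (by simpa using h) (hno d (applySubst (phi β m p) Y) i j)
  | cons c X ih =>
    cases Y with
    | nil => exact absurd (by simpa using h.symm) (hno c (applySubst (phi β m p) X) j i)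
    | cons d Y =>
      simp only [applySubst_cons, List.append_assoc] at h
      obtain ⟨rfl, h'⟩ := hβ.phi_append_inj (hX c (by simp)) (hY d (by simp)) h
      obtain ⟨rfl, h3⟩ := ih (fun x hx => hX x (by simp [hx])) (fun x hx => hY x (by simp [hx])) h'
      exact ⟨rfl, h3⟩

/-- Cutting the image of a word in front of one of its letters. -/
theorem exists_cut_of_applySubst_eq {X l r : List ℕ} {e : ℕ}
    (h : applySubst (phi β m p) X = l ++ e :: r) :
    ∃ X₁ c X₂ i r', X = X₁ ++ c :: X₂ ∧ l = applySubst (phi β m p) X₁ ++ List.replicate i 0 ∧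
      i ≤ digit β c ∧ phi β m p c = List.replicate i 0 ++ e :: r' ∧
      r = r' ++ applySubst (phi β m p) X₂ := by
  induction X generalizing l with
  | nil => simp at h
  | cons c X ih =>
    rw [applySubst_cons, List.append_eq_append_iff] at h
    have key : ∀ l', l = phi β m p c ++ l' → applySubst (phi β m p) X = l' ++ e :: r →
        ∃ X₁ d X₂ i r', c :: X = X₁ ++ d :: X₂ ∧
          l = applySubst (phi β m p) X₁ ++ List.replicate i 0 ∧
          i ≤ digit β d ∧ phi β m p d = List.replicate i 0 ++ e :: r' ∧
          r = r' ++ applySubst (phi β m p) X₂ := fun l' h1 h2 => by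
      obtain ⟨X₁, d, X₂, i, r', rfl, h3, h4⟩ := ih h2
      exact ⟨c :: X₁, d, X₂, i, r', by simp, by simp [h1, h3], h4⟩
    rcases h with ⟨l', h1, h2⟩ | ⟨c', h1, h2⟩
    · exact key l' h1 h2
    · rcases c' with - | ⟨e', r'⟩
      · exact key [] (by simpa using h1.symm) (by simpa using h2.symm)
      · simp only [List.cons_append, List.cons.injEq] at h2
        obtain ⟨rfl, h2⟩ := h2
        have hl : ∃ i, i ≤ digit β c ∧ l = List.replicate i 0 := by
          rw [phi_eq, List.append_eq_append_iff] at h1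
          rcases h1 with ⟨q, h3, h4⟩ | ⟨q, h3, h4⟩
          · rcases q with - | ⟨q, q'⟩
            · exact ⟨digit β c, le_rfl, by simpa using h3⟩
            · simp at h4
          · have h5 := List.append_eq_replicate_iff.1 h3.symm
            exact ⟨l.length, by omega, h5.2.1⟩
        obtain ⟨i, hi, rfl⟩ := hl
        exact ⟨[], c, X, i, r', rfl, by simp, hi, h1, h2⟩

/-- The finite factors of the words `φ_β^n(0)`. -/
def Lang (β : ℝ) (m p : ℕ) : Set (List ℕ) := {v | ∃ n, v <:+: phiIter β m p n [0]}

theorem phiIter_succ (n : ℕ) (w : List ℕ) :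
    phiIter β m p (n + 1) w = applySubst (phi β m p) (phiIter β m p n w) :=
  Function.iterate_succ_apply' _ _ _

theorem applySubst_prefix {v w : List ℕ} (h : v <+: w) :
    applySubst (phi β m p) v <+: applySubst (phi β m p) w := by
  obtain ⟨t, rfl⟩ := h; simp

theorem applySubst_infix {v w : List ℕ} (h : v <:+: w) :
    applySubst (phi β m p) v <:+: applySubst (phi β m p) w := by
  obtain ⟨s, t, rfl⟩ := h
  exact ⟨applySubst (phi β m p) s, applySubst (phi β m p) t, by simp⟩

theorem phi_ne_nil (k : ℕ) : phi β m p k ≠ [] := by simp [phi_eq]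

theorem length_le_length_applySubst (w : List ℕ) :
    w.length ≤ (applySubst (phi β m p) w).length := by
  induction w with
  | nil => simp
  | cons c w ih => simp [phi_eq]; omega

namespace IsNonSimpleParry

theorem exists_phi_zero (hβ : IsNonSimpleParry β m p) :
    ∃ r, phi β m p 0 = 0 :: r ∧ r ≠ [] := by
  refine ⟨List.replicate (digit β 0 - 1) 0 ++ [succLetter m p 0], ?_, by simp⟩
  rw [phi_eq, ← List.cons_append, ← List.replicate_succ,
    Nat.sub_add_cancel (Nat.succ_le_of_lt hβ.digit_zero_pos)]

theorem exists_phiIter_eq_cons (hβ : IsNonSimpleParry β m p) (n : ℕ) :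
    ∃ r, phiIter β m p n [0] = 0 :: r := by
  obtain ⟨r, hr, -⟩ := hβ.exists_phi_zero
  induction n with
  | zero => exact ⟨[], rfl⟩
  | succ n ih =>
    obtain ⟨r', h⟩ := ih
    exact ⟨r ++ applySubst (phi β m p) r', by rw [phiIter_succ, h]; simp [hr]⟩

theorem phiIter_prefix_succ (hβ : IsNonSimpleParry β m p) (n : ℕ) :
    phiIter β m p n [0] <+: phiIter β m p (n + 1) [0] := by
  induction n with
  | zero =>
    obtain ⟨r, hr⟩ := hβ.exists_phiIter_eq_cons 1
    rw [hr]; exact ⟨r, rfl⟩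
  | succ n ih => rw [phiIter_succ, phiIter_succ (n + 1)]; exact applySubst_prefix ih

theorem phiIter_prefix (hβ : IsNonSimpleParry β m p) {k n : ℕ} (h : k ≤ n) :
    phiIter β m p k [0] <+: phiIter β m p n [0] := by
  induction n, h using Nat.le_induction with
  | base => exact List.prefix_rfl
  | succ n _ ih => exact ih.trans (hβ.phiIter_prefix_succ n)

theorem lt_length_phiIter (hβ : IsNonSimpleParry β m p) (n : ℕ) :
    n < (phiIter β m p n [0]).length := by
  induction n with
  | zero => simp [phiIter]
  | succ n ih =>
    obtain ⟨r, hr⟩ := hβ.exists_phiIter_eq_cons n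
    obtain ⟨r', hr', hne⟩ := hβ.exists_phi_zero
    have h1 := length_le_length_applySubst (β := β) (m := m) (p := p) r
    have h2 := List.length_pos_iff.2 hne
    rw [hr] at ih
    rw [phiIter_succ, hr]
    simp [hr'] at ih ⊢
    omega

theorem getElem_phiIter (hβ : IsNonSimpleParry β m p) {n i : ℕ}
    (h : i < (phiIter β m p n [0]).length) : (phiIter β m p n [0])[i] = uBeta β m p i := by
  have hi := hβ.lt_length_phiIter i
  rw [uBeta, List.getD_eq_getElem _ _ hi]
  rcases le_total n i with h1 | h1
  · exact (hβ.phiIter_prefix h1).getElem h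
  · exact ((hβ.phiIter_prefix h1).getElem hi).symm

theorem isFactor_iff (hβ : IsNonSimpleParry β m p) {v : List ℕ} :
    IsFactor (uBeta β m p) v ↔ v ∈ Lang β m p := by
  constructor
  · rintro ⟨j, hj⟩
    refine ⟨j + v.length, ?_⟩
    have h := hβ.lt_length_phiIter (j + v.length)
    have : v = ((phiIter β m p (j + v.length) [0]).drop j).take v.length := by
      refine List.ext_getElem (by simp; omega) fun i h1 h2 => ?_
      rw [List.getElem_take, List.getElem_drop, hβ.getElem_phiIter]
      conv_lhs => rw [List.getElem_of_eq hj]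
      simp
    conv_lhs => rw [this]
    exact ((List.take_prefix _ _).isInfix).trans (List.drop_suffix _ _).isInfix
  · rintro ⟨n, s, t, h⟩
    refine ⟨s.length, List.ext_getElem (by simp) fun i h1 h2 => ?_⟩
    simp only [List.getElem_map, List.getElem_range]
    have h3 : s.length + i < (phiIter β m p n [0]).length := by rw [← h]; simp; omega
    rw [← hβ.getElem_phiIter h3]
    simp [← h, h1]

theorem mem_rext_iff (hβ : IsNonSimpleParry β m p) {v : List ℕ} {c : ℕ} :
    c ∈ rext (uBeta β m p) v ↔ v ++ [c] ∈ Lang β m p := hβ.isFactor_iff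

theorem mem_lext_iff (hβ : IsNonSimpleParry β m p) {v : List ℕ} {c : ℕ} :
    c ∈ lext (uBeta β m p) v ↔ c :: v ∈ Lang β m p := hβ.isFactor_iff

theorem exists_preimage (hβ : IsNonSimpleParry β m p) {v : List ℕ} (hv : v ∈ Lang β m p) :
    ∃ X ∈ Lang β m p, v <:+: applySubst (phi β m p) X := by
  obtain ⟨n, hn⟩ := hv
  refine ⟨phiIter β m p n [0], ⟨n, List.infix_rfl⟩, ?_⟩
  rw [← phiIter_succ]
  exact hn.trans (hβ.phiIter_prefix_succ n).isInfix

theorem lt_of_mem_of_mem_lang (hβ : IsNonSimpleParry β m p) {v : List ℕ}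
    (hv : v ∈ Lang β m p) : ∀ x ∈ v, x < m + p := by
  obtain ⟨n, hn⟩ := hv
  have hm := hβ.m_pos
  suffices h : ∀ n, ∀ x ∈ phiIter β m p n [0], x < m + p from fun x hx => h n x (hn.subset hx)
  intro n
  induction n with
  | zero => simp [phiIter]; omega
  | succ n ih =>
    intro x hx
    rw [phiIter_succ, applySubst, List.mem_flatMap] at hx
    obtain ⟨c, -, hx⟩ := hx
    rw [phi_eq, List.mem_append] at hx
    rcases hx with hx | hx
    · rw [List.eq_of_mem_replicate hx]; omega
    · rw [List.mem_singleton.1 hx]; exact succLetter_lt hβ.p_pos c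

end IsNonSimpleParry

theorem Lang.of_infix {v w : List ℕ} (hw : w ∈ Lang β m p) (h : v <:+: w) : v ∈ Lang β m p := by
  obtain ⟨n, hn⟩ := hw; exact ⟨n, h.trans hn⟩

theorem Lang.applySubst_mem {v : List ℕ} (hv : v ∈ Lang β m p) :
    applySubst (phi β m p) v ∈ Lang β m p := by
  obtain ⟨n, hn⟩ := hv
  exact ⟨n + 1, by rw [phiIter_succ]; exact applySubst_infix hn⟩

namespace IsNonSimpleParry

theorem exists_right_extension (hβ : IsNonSimpleParry β m p) {v : List ℕ}
    (hv : v ∈ Lang β m p) : ∃ c, v ++ [c] ∈ Lang β m p := by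
  obtain ⟨j, hj⟩ := hβ.isFactor_iff.2 hv
  refine ⟨uBeta β m p (j + v.length), hβ.isFactor_iff.1 ⟨j, ?_⟩⟩
  rw [List.length_append, List.length_singleton, List.range_succ, List.map_append, ← hj]
  rfl

/-- Every φ^n(0) starts with 0, so a factor with nonzero first letter is never a prefix. -/
theorem exists_left_extension (hβ : IsNonSimpleParry β m p) {v : List ℕ} {y : ℕ} (hy : y ≠ 0)
    (hv : y :: v ∈ Lang β m p) : ∃ c, c :: y :: v ∈ Lang β m p := by
  obtain ⟨n, s, t, h⟩ := hv
  rcases List.eq_nil_or_concat s with rfl | ⟨s, c, rfl⟩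
  · obtain ⟨r, hr⟩ := hβ.exists_phiIter_eq_cons n
    rw [hr] at h
    simp at h
    exact absurd h.1 hy
  · exact ⟨c, n, s, t, by rw [← h]; simp⟩

/-- Maximal right extensions with respect to the lexicographic order exist. -/
theorem exists_isLexGreatestRext (hβ : IsNonSimpleParry β m p) {v : List ℕ}
    (hv : v ∈ Lang β m p) : ∃ c, IsLexGreatestRext β m p v c := by
  obtain ⟨c, hc⟩ := hβ.exists_right_extension hv
  have hfin : (rext (uBeta β m p) v).Finite := (Set.finite_lt_nat (m + p)).subset fun x hx =>
    hβ.lt_of_mem_of_mem_lang (hβ.mem_rext_iff.1 hx) x (by simp)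
  obtain ⟨d, hd, hmax⟩ := hfin.exists_maximalFor (key β) _ ⟨c, hβ.mem_rext_iff.2 hc⟩
  refine ⟨d, hd, fun c' hc' => ?_⟩
  rcases le_total (key β c') (key β d) with h | h
  · exact h
  · exact hmax hc' h

end IsNonSimpleParry

end Substitution

end ParryWord

namespace ParryWord

/-! ### Desubstitution, unique left extensions, and extensions by zero. -/

section Desubstitution

variable {β : ℝ} {m p : ℕ}

theorem le_of_replicate_append_eq {α : Type*} {z s : α} (hs : s ≠ z) {k q : ℕ} {r y : List α}
    (h : List.replicate k z ++ r = List.replicate q z ++ s :: y) : k ≤ q := by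
  induction k generalizing q with
  | zero => omega
  | succ k ih =>
    cases q with
    | zero => simp [List.replicate_succ] at h; exact absurd h.1.symm hs
    | succ q =>
      simp only [List.replicate_succ, List.cons_append, List.cons.injEq, true_and] at h
      have := ih h
      omega

theorem phi_eq_replicate_append_cons (hm : 0 < m) {c n e : ℕ} {r : List ℕ}
    (h : phi β m p c = List.replicate n 0 ++ e :: r) :
    (n < digit β c ∧ e = 0 ∧ r = List.replicate (digit β c - (n + 1)) 0 ++ [succLetter m p c]) ∨
      (n = digit β c ∧ e = succLetter m p c ∧ r = []) := by
  rw [phi_eq] at h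
  by_cases he : e = 0
  · subst he
    have h' : List.replicate (n + 1) 0 ++ r =
        List.replicate (digit β c) 0 ++ [succLetter m p c] := by
      rw [h, List.replicate_succ']; simp
    have hn := le_of_replicate_append_eq (succLetter_pos hm c) h'
    refine Or.inl ⟨hn, rfl, ?_⟩
    have hd : digit β c = n + 1 + (digit β c - (n + 1)) := (Nat.add_sub_cancel' hn).symm
    rw [hd, List.replicate_add (n + 1), List.append_assoc] at h'
    exact List.append_cancel_left h'
  · obtain ⟨h1, h2, h3⟩ := replicate_append_cons_inj (succLetter_pos hm c) he h
    exact Or.inr ⟨h1.symm, h2.symm, h3.symm⟩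

theorem exists_phi_eq_replicate_append_cons {c n : ℕ} (h : n ≤ digit β c) :
    ∃ e r, phi β m p c = List.replicate n 0 ++ e :: r := by
  rcases h.lt_or_eq with h | rfl
  · refine ⟨0, List.replicate (digit β c - (n + 1)) 0 ++ [succLetter m p c], ?_⟩
    rw [phi_eq, ← List.cons_append, ← List.replicate_succ, ← List.append_assoc,
      ← List.replicate_add]
    congr 2
    omega
  · exact ⟨_, [], rfl⟩

namespace IsNonSimpleParry

/-- Images end in nonzero letters, so a run of zeros lies inside a single image. -/
theorem le_digit_zero_of_replicate_mem (hβ : IsNonSimpleParry β m p) {i : ℕ}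
    (h : List.replicate i 0 ∈ Lang β m p) : i ≤ digit β 0 := by
  rcases i with - | k
  · omega
  obtain ⟨X, -, l, r, hX⟩ := hβ.exists_preimage h
  obtain ⟨X₁, c, X₂, n, r', -, -, -, h4, h5⟩ := exists_cut_of_applySubst_eq (β := β) (m := m)
    (p := p) (X := X) (l := l) (e := 0) (r := List.replicate k 0 ++ r)
    (by rw [← hX, List.replicate_succ]; simp)
  have hc := hβ.digit_le c
  rcases phi_eq_replicate_append_cons hβ.m_pos h4 with ⟨h6, -, rfl⟩ | ⟨-, h6, -⟩
  · rw [List.append_assoc, List.singleton_append] at h5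
    have := le_of_replicate_append_eq (succLetter_pos hβ.m_pos c) h5
    omega
  · exact absurd h6.symm (succLetter_pos hβ.m_pos c)

/-- Either the zero block of φ(d) continues and `f = 0` is the greatest letter, or it stops at n;
then that of φ(c) stops there too, and equal first digits are removed from both tails. -/
theorem key_le_of_phi_eq (hβ : IsNonSimpleParry β m p) {c d n e f : ℕ} {r s : List ℕ}
    (hc : c < m + p) (hd : d < m + p) (h : key β c ≤ key β d)
    (h1 : phi β m p c = List.replicate n 0 ++ e :: r)
    (h2 : phi β m p d = List.replicate n 0 ++ f :: s) : key β e ≤ key β f := by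
  have h3 := digit_le_of_key_le h
  rcases phi_eq_replicate_append_cons hβ.m_pos h2 with ⟨-, rfl, -⟩ | ⟨h4, rfl, -⟩
  · exact key_le_key_zero hβ.one_lt e
  · rcases phi_eq_replicate_append_cons hβ.m_pos h1 with ⟨h5, -, -⟩ | ⟨h5, rfl, -⟩
    · omega
    · rw [hβ.key_succLetter hc, hβ.key_succLetter hd]
      exact key_succ_le_of_key_le h (by omega)

/-- Desubstitution of a factor that contains a nonzero letter. -/
theorem exists_desubstitution (hβ : IsNonSimpleParry β m p) {a j x e : ℕ} {W : List ℕ}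
    (hx : x ≠ 0) (h : a :: (List.replicate j 0 ++ x :: W) ++ [e] ∈ Lang β m p) :
    ∃ y Y c i r, x = succLetter m p y ∧ W = applySubst (phi β m p) Y ++ List.replicate i 0 ∧
      i ≤ digit β c ∧ phi β m p c = List.replicate i 0 ++ e :: r ∧
      y :: Y ++ [c] ∈ Lang β m p ∧
      ((j < digit β y ∧ a = 0) ∨
        (j = digit β y ∧ ∃ a', a = succLetter m p a' ∧ a' :: y :: Y ++ [c] ∈ Lang β m p)) := by
  obtain ⟨X, hXL, l, r, hX⟩ := hβ.exists_preimage h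
  obtain ⟨X₁, y, X₂, n, r₁, rfl, h1, -, h2, h3⟩ := exists_cut_of_applySubst_eq (β := β) (m := m)
    (p := p) (X := X) (l := l ++ a :: List.replicate j 0) (e := x) (r := W ++ e :: r)
    (by rw [← hX]; simp)
  rcases phi_eq_replicate_append_cons hβ.m_pos h2 with ⟨-, h4, -⟩ | ⟨rfl, h4, rfl⟩
  · exact absurd h4 hx
  obtain ⟨Y, c, X₃, i, r₂, rfl, h5, h6, h7, -⟩ := exists_cut_of_applySubst_eq (β := β) (m := m)
    (p := p) (X := X₂) (l := W) (e := e) (r := r) h3.symm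
  refine ⟨y, Y, c, i, r₂, h4, h5, h6, h7, Lang.of_infix hXL ⟨X₁, X₃, by simp⟩, ?_⟩
  -- With too few zeros, `a` is itself in the zero block of φ(y). Otherwise the surplus zeros would
  -- end the preceding image, whose last letter is nonzero; so there are none and `a` is that last
  -- letter.
  rcases lt_or_ge j (digit β y) with hj | hj
  · refine Or.inl ⟨hj, ?_⟩
    have h8 : (l ++ [a]) ++ List.replicate j 0 = (applySubst (phi β m p) X₁ ++
        List.replicate (digit β y - (j + 1)) 0 ++ [0]) ++ List.replicate j 0 := by
      have : digit β y = (digit β y - (j + 1)) + (j + 1) := by omega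
      rw [this, List.replicate_add, List.replicate_succ] at h1
      simpa using h1
    simpa using (List.append_inj' (List.append_cancel_right h8) rfl).2
  · refine Or.inr ?_
    have h8 : (l ++ a :: List.replicate (j - digit β y) 0) ++ List.replicate (digit β y) 0 =
        applySubst (phi β m p) X₁ ++ List.replicate (digit β y) 0 := by
      rw [← h1, List.append_assoc, List.cons_append, ← List.replicate_add, Nat.sub_add_cancel hj]
    have h9 := List.append_cancel_right h8
    rcases List.eq_nil_or_concat' X₁ with rfl | ⟨X₄, a', rfl⟩
    · simp at h9
    · rw [applySubst_append, applySubst_cons, applySubst_nil, List.append_nil, phi_eq,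
        ← List.append_assoc] at h9
      have h10 : j = digit β y := by
        by_contra hne
        obtain ⟨q, hq⟩ : ∃ q, j - digit β y = q + 1 := ⟨j - digit β y - 1, by omega⟩
        rw [hq, List.replicate_succ', ← List.cons_append, ← List.append_assoc] at h9
        have := (List.append_inj' h9 rfl).2
        exact succLetter_pos hβ.m_pos a' (by simpa using this.symm)
      subst h10
      rw [Nat.sub_self, List.replicate_zero] at h9
      refine ⟨rfl, a', by simpa using (List.append_inj' h9 rfl).2, ?_⟩
      exact Lang.of_infix hXL ⟨X₄, X₃, by simp⟩

theorem left_letter (hβ : IsNonSimpleParry β m p) {c x : ℕ} (hx : x ≠ 0)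
    (h : [c, x] ∈ Lang β m p) : ∃ d < m + p, x = succLetter m p d ∧ ((0 < digit β d ∧ c = 0) ∨
      (0 = digit β d ∧ ∃ c', c = succLetter m p c' ∧ [c', d] ∈ Lang β m p)) := by
  obtain ⟨e, he⟩ := hβ.exists_right_extension h
  obtain ⟨y, Y, c', i, r, h1, -, -, -, h2, h3⟩ :=
    hβ.exists_desubstitution (j := 0) (W := []) hx he
  refine ⟨y, hβ.lt_of_mem_of_mem_lang h2 y (by simp), h1, h3.imp_right ?_⟩
  rintro ⟨h4, a', h5, h6⟩
  exact ⟨h4, a', h5, Lang.of_infix h6 ⟨[], Y ++ [c'], by simp⟩⟩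

/-- A letter with exactly one preimage has only one left extension if its preimage does, or if its
preimage is preceded by zeros in the image. -/
theorem left_letter_unique_succ (hβ : IsNonSimpleParry β m p) {k : ℕ} (hk : k + 1 ≠ m)
    (h : 0 < digit β k ∨ ∀ c c', [c, k] ∈ Lang β m p → [c', k] ∈ Lang β m p → c = c') :
    ∀ c c', [c, k + 1] ∈ Lang β m p → [c', k + 1] ∈ Lang β m p → c = c' := by
  intro c c' hc hc'
  obtain ⟨d, hd, h1, h2⟩ := hβ.left_letter (Nat.succ_ne_zero k) hc
  obtain ⟨d', hd', h1', h2'⟩ := hβ.left_letter (Nat.succ_ne_zero k) hc'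
  have e1 : d = k := eq_of_succLetter_eq_succ h1 hk
  have e2 : d' = k := eq_of_succLetter_eq_succ h1' hk
  subst e1 e2
  rcases h2 with ⟨h3, rfl⟩ | ⟨h3, a, rfl, h4⟩ <;> rcases h2' with ⟨h3', rfl⟩ | ⟨h3', a', rfl, h4'⟩
  · rfl
  · omega
  · omega
  · rcases h with h | h
    · omega
    · rw [h a a' h4 h4']

/-- Of the two preimages of the letter `m`, the one with the shorter image has only one left
extension. -/
theorem left_letter_unique (hβ : IsNonSimpleParry β m p) {y y' : ℕ} (hy : y < m + p)
    (hy' : y' < m + p) (h : succLetter m p y = succLetter m p y') (hlt : digit β y < digit β y') :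
    ∀ c c', [c, y] ∈ Lang β m p → [c', y] ∈ Lang β m p → c = c' := by
  have hm := hβ.m_pos
  have hp := hβ.p_pos
  -- A nonzero digit at j makes the left extension of `j + 1` unique; uniqueness climbs from there
  -- as long as the letter m, with its two preimages, is not crossed.
  have hup : ∀ j n, 0 < digit β j → (m ≤ j ∨ j + 1 + n < m) →
      ∀ c c', [c, j + 1 + n] ∈ Lang β m p → [c', j + 1 + n] ∈ Lang β m p → c = c' := by
    intro j n hj hjn
    induction n with
    | zero => exact hβ.left_letter_unique_succ (by omega) (Or.inl hj)
    | succ n ih =>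
      exact hβ.left_letter_unique_succ (k := j + 1 + n) (by omega) (Or.inr (ih (by omega)))
  rcases eq_or_of_succLetter_eq hy hy' h with rfl | ⟨rfl, rfl⟩ | ⟨rfl, rfl⟩
  · omega
  · have h0 : m ≠ 1 := by
      rintro rfl
      exact absurd (hβ.digit_le (1 + p - 1)) (not_le.2 (by simpa using hlt))
    have := hup 0 (m - 2) hβ.digit_zero_pos (Or.inr (by omega))
    rwa [show 0 + 1 + (m - 2) = m - 1 by omega] at this
  · by_cases hex : ∃ j, m ≤ j ∧ j + 1 < m + p ∧ 0 < digit β j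
    · obtain ⟨j, h1, h2, h3⟩ := hex
      have := hup j (m + p - 1 - (j + 1)) h3 (Or.inl h1)
      rwa [show j + 1 + (m + p - 1 - (j + 1)) = m + p - 1 by omega] at this
    · push Not at hex
      -- Only the last digit of the period is nonzero here. Both images ending in m then contain
      -- zeros, so m is always preceded by 0 and the climb can start at m.
      have hz : ∀ n, n + 1 < p → digit β (m + n) = 0 := fun n hn =>
        Nat.le_zero.1 (hex (m + n) (by omega) (by omega))
      have hlast : 0 < digit β (m + p - 1) := by
        by_contra h0
        have hall : ∀ n, digit β (m + n) = 0 := by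
          intro n
          induction n using Nat.strong_induction_on with
          | _ n ih =>
            rcases lt_or_ge n p with h1 | h1
            · rcases eq_or_ne (n + 1) p with h2 | h2
              · rw [show m + n = m + p - 1 by omega]; omega
              · exact hz n (by omega)
            · have := hβ.shape (m + (n - p)) (by omega)
              rw [show m + (n - p) + p = m + n by omega] at this
              rw [this]
              exact ih (n - p) (by omega)
        obtain ⟨n, h1, h2⟩ := hβ.not_finite m
        exact h2 (by have := hall (n - m); rwa [Nat.add_sub_cancel' h1] at this)
      have hm0 : ∀ c, [c, m] ∈ Lang β m p → c = 0 := by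
        intro c hc
        obtain ⟨d, hd, h1, h2⟩ := hβ.left_letter (by omega) hc
        have hd' := eq_or_of_succLetter_eq_self hd h1
        rcases h2 with ⟨-, h2⟩ | ⟨h2, -⟩
        · exact h2
        · rcases hd' with rfl | rfl <;> omega
      have : ∀ n, ∀ c c', [c, m + n] ∈ Lang β m p → [c', m + n] ∈ Lang β m p → c = c' := by
        intro n
        induction n with
        | zero => intro c c' hc hc'; rw [hm0 c hc, hm0 c' hc']
        | succ n ih => exact hβ.left_letter_unique_succ (k := m + n) (by omega) (Or.inr ih)
      have := this (p - 1)
      rwa [← Nat.add_sub_assoc hp] at this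

/-! Right extensions by `0`. -/

theorem append_zero_mem_of_le (hβ : IsNonSimpleParry β m p) {q k : ℕ}
    (h : [q, 0] ∈ Lang β m p) (hqk : q ≤ k) (hk : k < m + p) : [k, 0] ∈ Lang β m p := by
  induction k, hqk using Nat.le_induction with
  | base => exact h
  | succ k hqk ih =>
    obtain ⟨r, hr, -⟩ := hβ.exists_phi_zero
    refine Lang.of_infix (Lang.applySubst_mem (ih (by omega)))
      ⟨List.replicate (digit β k) 0, r, ?_⟩
    simp [phi_eq β m p k, hr, succLetter_of_lt hk]

theorem phi_zero_mem : phi β m p 0 ∈ Lang β m p :=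
  ⟨1, by simp [phiIter]⟩

theorem zero_zero_mem (h : 1 < digit β 0) :
    [0, 0] ∈ Lang β m p := by
  refine Lang.of_infix phi_zero_mem
    ⟨[], List.replicate (digit β 0 - 2) 0 ++ [succLetter m p 0], ?_⟩
  obtain ⟨n, hn⟩ : ∃ n, digit β 0 = n + 2 := ⟨digit β 0 - 2, by omega⟩
  simp [phi_eq, hn, List.replicate_succ]

/-- Both preimages of the letter `m` can be followed by `0`. -/
theorem pred_zero_mem (hβ : IsNonSimpleParry β m p) (h : 1 < digit β 0 ∨ 2 ≤ m) :
    [m - 1, 0] ∈ Lang β m p ∧ [m + p - 1, 0] ∈ Lang β m p := by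
  have hm := hβ.m_pos
  have hp := hβ.p_pos
  suffices hq : ∃ q ≤ m - 1, [q, 0] ∈ Lang β m p by
    obtain ⟨q, hq, h1⟩ := hq
    exact ⟨hβ.append_zero_mem_of_le h1 hq (by omega),
      hβ.append_zero_mem_of_le h1 (by omega) (by omega)⟩
  rcases lt_or_ge 1 (digit β 0) with h1 | h1
  · exact ⟨0, by omega, zero_zero_mem h1⟩
  · have h1 : digit β 0 = 1 := le_antisymm h1 hβ.digit_zero_pos
    obtain ⟨r, hr0, hrm, hr⟩ := hβ.exists_digit_pos h1 (by omega)
    by_contra! hno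
    -- Starting from φ(0) = 01, the image of the pair i, i+1 contains i+1 followed by the first
    -- letter of φ(i+1). That letter is i+2 until a nonzero digit is reached, when it becomes 0.
    have hstep : ∀ i, i < r → [i, i + 1] ∈ Lang β m p := by
      intro i hi
      induction i with
      | zero =>
        have := phi_zero_mem (β := β) (m := m) (p := p)
        rw [phi_eq, h1, succLetter_of_lt (by omega)] at this
        exact this
      | succ i ih =>
        have h2 := Lang.applySubst_mem (ih (by omega))
        simp only [applySubst_cons, applySubst_nil, List.append_nil] at h2
        rcases Nat.eq_zero_or_pos (digit β (i + 1)) with h3 | h3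
        · refine Lang.of_infix h2 ⟨List.replicate (digit β i) 0, [], ?_⟩
          rw [phi_eq, phi_eq, h3, succLetter_of_lt (by omega), succLetter_of_lt (by omega)]
          simp
        · refine absurd (Lang.of_infix h2 ⟨List.replicate (digit β i) 0,
            List.replicate (digit β (i + 1) - 1) 0 ++ [succLetter m p (i + 1)], ?_⟩)
            (hno (i + 1) (by omega))
          obtain ⟨n, hn⟩ := Nat.exists_eq_succ_of_ne_zero h3.ne'
          simp [phi_eq, hn, List.replicate_succ, succLetter_of_lt (show i + 1 < m + p by omega)]
    obtain ⟨s, rfl⟩ := Nat.exists_eq_succ_of_ne_zero hr0.ne'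
    have h2 := Lang.applySubst_mem (hstep s (by omega))
    refine absurd (Lang.of_infix h2 ⟨List.replicate (digit β s) 0,
      List.replicate (digit β (s + 1) - 1) 0 ++ [succLetter m p (s + 1)], ?_⟩)
      (hno (s + 1) (by omega))
    obtain ⟨n, hn⟩ := Nat.exists_eq_succ_of_ne_zero hr.ne'
    simp [phi_eq, hn, List.replicate_succ, succLetter_of_lt (show s + 1 < m + p by omega)]

end IsNonSimpleParry

end Desubstitution

end ParryWord

namespace ParryWord

/-! ### Common prefixes and suffixes, and symmetry of g_L. -/

section CommonPrefix

variable {α : Type*} [DecidableEq α]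

theorem lcp_comm (v w : List α) : lcp v w = lcp w v := by
  induction v generalizing w with
  | nil => cases w <;> rfl
  | cons x v ih =>
    cases w with
    | nil => rfl
    | cons y w =>
      unfold lcp
      by_cases h : x = y
      · subst h; simp [ih]
      · simp [h, Ne.symm h]

theorem lcp_append_append (l v w : List α) : lcp (l ++ v) (l ++ w) = l ++ lcp v w := by
  induction l with
  | nil => rfl
  | cons x l ih => simp [lcp, ih]

theorem lcp_cons_of_ne {x y : α} (h : x ≠ y) (v w : List α) : lcp (x :: v) (y :: w) = [] := by
  simp [lcp, h]

theorem lcp_self_append (l r : List α) : lcp l (l ++ r) = l := by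
  have := lcp_append_append l [] r
  rw [List.append_nil] at this
  rw [this]
  cases r <;> simp [lcp]

theorem fL_comm (φ : α → List α) (a b : α) : fL φ a b = fL φ b a := by
  rw [fL, fL, lcs, lcs, lcp_comm]

theorem fL_eq_left {φ : α → List α} {a b : α} {q : List α} (h : φ b = q ++ φ a) :
    fL φ a b = φ a := by
  rw [fL, lcs, h, List.reverse_append, lcp_self_append, List.reverse_reverse]

/-- The definition tests its first argument first; distinct images ensure that at most one of the
two suffix cases applies. -/
theorem gL_comm {φ : α → List α} (u : ℕ → α) {a b : α} (h : φ a ≠ φ b) :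
    gL φ u a b = gL φ u b a := by
  unfold gL
  rw [fL_comm φ b a]
  by_cases h1 : fL φ a b = φ a
  · rw [if_pos h1, if_neg (fun h2 => h (h1.symm.trans h2)), if_pos h1]
  · by_cases h2 : fL φ a b = φ b
    · rw [if_neg h1, if_pos h2, if_pos h2]
    · rw [if_neg h1, if_neg h2, if_neg h2, if_neg h1]
      ext x
      exact or_comm

end CommonPrefix

/-! ### Preimages of words with distinct greatest right extensions. -/

section Preimage

variable {β : ℝ} {m p : ℕ}

/-- The words `av` and `bv` have distinct lexicographically greatest right extensions `e`, `f`. -/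
def IsLexSplit (β : ℝ) (m p a b : ℕ) (v : List ℕ) (e f : ℕ) : Prop :=
  a ≠ b ∧ IsLexGreatestRext β m p (a :: v) e ∧ IsLexGreatestRext β m p (b :: v) f ∧ e ≠ f

/-- The word `v` with left extensions `a, b` and the right extensions `e, f` come from the
word `v'` with left extensions `a', b'` and right extensions `c, d`. -/
def IsLexPreimage (β : ℝ) (m p a b : ℕ) (v : List ℕ) (e f a' b' : ℕ) (v' : List ℕ)
    (c d : ℕ) : Prop :=
  IsLexSplit β m p a' b' v' c d ∧ gL (phi β m p) (uBeta β m p) a' b' = {a, b} ∧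
    ∃ i r s, v = fL (phi β m p) a' b' ++ applySubst (phi β m p) v' ++ List.replicate i 0 ∧
      phi β m p c = List.replicate i 0 ++ e :: r ∧ phi β m p d = List.replicate i 0 ++ f :: s

theorem IsLexSplit.symm {a b e f : ℕ} {v : List ℕ} (h : IsLexSplit β m p a b v e f) :
    IsLexSplit β m p b a v f e := ⟨h.1.symm, h.2.2.1, h.2.1, h.2.2.2.symm⟩

namespace IsNonSimpleParry

theorem phi_ne (hβ : IsNonSimpleParry β m p) {a b : ℕ} (ha : a < m + p) (hb : b < m + p)
    (h : a ≠ b) : phi β m p a ≠ phi β m p b := fun h1 =>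
  h (hβ.phi_append_inj ha hb (x := []) (y := []) (by rw [h1])).1

theorem mem_lang_of_greatest (hβ : IsNonSimpleParry β m p) {v : List ℕ} {e : ℕ}
    (h : IsLexGreatestRext β m p v e) : v ++ [e] ∈ Lang β m p := hβ.mem_rext_iff.1 h.1

theorem lt_of_greatest (hβ : IsNonSimpleParry β m p) {v : List ℕ} {e : ℕ}
    (h : IsLexGreatestRext β m p v e) : ∀ x ∈ v ++ [e], x < m + p :=
  hβ.lt_of_mem_of_mem_lang (hβ.mem_lang_of_greatest h)

theorem eq_of_greatest (hβ : IsNonSimpleParry β m p) {v : List ℕ} {e e' : ℕ}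
    (h : IsLexGreatestRext β m p v e) (h' : v ++ [e'] ∈ Lang β m p)
    (hle : key β e ≤ key β e') : e = e' :=
  hβ.key_injOn (hβ.lt_of_greatest h e (by simp)) (hβ.lt_of_mem_of_mem_lang h' e' (by simp))
    (le_antisymm hle (h.2 e' (hβ.mem_rext_iff.2 h')))

theorem eq_zero_of_greatest (hβ : IsNonSimpleParry β m p) {v : List ℕ} {e : ℕ}
    (h : IsLexGreatestRext β m p v e) (h' : v ++ [0] ∈ Lang β m p) : e = 0 :=
  hβ.eq_of_greatest h h' (key_le_key_zero hβ.one_lt e)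

theorem _root_.ParryWord.IsLexPreimage.swap (hβ : IsNonSimpleParry β m p)
    {a b e f a' b' c d : ℕ} {v v' : List ℕ}
    (h : IsLexPreimage β m p a b v e f a' b' v' c d) :
    IsLexPreimage β m p b a v f e b' a' v' d c := by
  obtain ⟨h1, h2, i, r, s, h3, h4, h5⟩ := h
  have ha := hβ.lt_of_greatest h1.2.1 a' (by simp)
  have hb := hβ.lt_of_greatest h1.2.2.1 b' (by simp)
  exact ⟨h1.symm, by rw [← gL_comm _ (hβ.phi_ne ha hb h1.1), h2, Set.pair_comm], i, s, r,
    by rw [h3, fL_comm], h5, h4⟩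

/-- Replacing `c` by the greatest right extension `d` of `a'v'` can only enlarge the letter read
after the i zeros. As `e` is already greatest, that letter stays `e`. -/
theorem exists_greatest_preimage (hβ : IsNonSimpleParry β m p) {a a' c e i : ℕ}
    {v' v₀ r : List ℕ}
    (H : ∀ c, a' :: v' ++ [c] ∈ Lang β m p → a :: v₀ ++ phi β m p c ∈ Lang β m p)
    (hc : a' :: v' ++ [c] ∈ Lang β m p) (hφ : phi β m p c = List.replicate i 0 ++ e :: r)
    (he : IsLexGreatestRext β m p (a :: (v₀ ++ List.replicate i 0)) e) :
    ∃ d, IsLexGreatestRext β m p (a' :: v') d ∧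
      ∃ s, phi β m p d = List.replicate i 0 ++ e :: s := by
  obtain ⟨d, hd⟩ := hβ.exists_isLexGreatestRext (v := a' :: v')
    (Lang.of_infix hc (List.prefix_append _ _).isInfix)
  have hcd : key β c ≤ key β d := hd.2 c (hβ.mem_rext_iff.2 hc)
  have hi : i ≤ digit β d := by
    have := digit_le_of_key_le hcd
    rcases phi_eq_replicate_append_cons hβ.m_pos hφ with ⟨h, -, -⟩ | ⟨h, -, -⟩ <;> omega
  obtain ⟨e', s, h1⟩ := exists_phi_eq_replicate_append_cons (m := m) (p := p) hi
  have hle := hβ.key_le_of_phi_eq (hβ.lt_of_mem_of_mem_lang hc c (by simp))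
    (hβ.lt_of_greatest hd d (by simp)) hcd hφ h1
  have hmem : a :: (v₀ ++ List.replicate i 0) ++ [e'] ∈ Lang β m p :=
    Lang.of_infix (H d (hβ.mem_lang_of_greatest hd)) ⟨[], s, by simp [h1]⟩
  obtain rfl := hβ.eq_of_greatest he hmem hle
  exact ⟨d, hd, s, h1⟩

theorem exists_isLexPreimage_of_lift (hβ : IsNonSimpleParry β m p)
    {a b a' b' c d e f i : ℕ} {v' v₀ r s : List ℕ} (hab : a' ≠ b')
    (hv₀ : v₀ = fL (phi β m p) a' b' ++ applySubst (phi β m p) v')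
    (hg : gL (phi β m p) (uBeta β m p) a' b' = {a, b})
    (Ha : ∀ c, a' :: v' ++ [c] ∈ Lang β m p → a :: v₀ ++ phi β m p c ∈ Lang β m p)
    (Hb : ∀ c, b' :: v' ++ [c] ∈ Lang β m p → b :: v₀ ++ phi β m p c ∈ Lang β m p)
    (hc : a' :: v' ++ [c] ∈ Lang β m p) (hd : b' :: v' ++ [d] ∈ Lang β m p)
    (hφc : phi β m p c = List.replicate i 0 ++ e :: r)
    (hφd : phi β m p d = List.replicate i 0 ++ f :: s)
    (h : IsLexSplit β m p a b (v₀ ++ List.replicate i 0) e f) :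
    ∃ c d, IsLexPreimage β m p a b (v₀ ++ List.replicate i 0) e f a' b' v' c d := by
  obtain ⟨c', h1, r', h2⟩ := hβ.exists_greatest_preimage Ha hc hφc h.2.1
  obtain ⟨d', h3, s', h4⟩ := hβ.exists_greatest_preimage Hb hd hφd h.2.2.1
  refine ⟨c', d', ⟨hab, h1, h3, ?_⟩, hg, i, r', s', by rw [hv₀], h2, h4⟩
  rintro rfl
  rw [h2] at h4
  exact h.2.2.2 (List.cons.inj (List.append_cancel_left h4)).1

/-- The case where `f_L` is empty. -/
theorem exists_isLexPreimage_of_eq (hβ : IsNonSimpleParry β m p)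
    {a' b' c d e f i : ℕ} {v' r s : List ℕ}
    (hc : a' :: v' ++ [c] ∈ Lang β m p) (hd : b' :: v' ++ [d] ∈ Lang β m p)
    (hφc : phi β m p c = List.replicate i 0 ++ e :: r)
    (hφd : phi β m p d = List.replicate i 0 ++ f :: s)
    (h : IsLexSplit β m p (succLetter m p a') (succLetter m p b')
      (applySubst (phi β m p) v' ++ List.replicate i 0) e f) :
    ∃ c d, IsLexPreimage β m p (succLetter m p a') (succLetter m p b')
      (applySubst (phi β m p) v' ++ List.replicate i 0) e f a' b' v' c d := by
  have hf : fL (phi β m p) a' b' = [] := by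
    simp [fL, lcs, phi_eq, lcp_cons_of_ne h.1]
  have hlift : ∀ a' c, a' :: v' ++ [c] ∈ Lang β m p →
      succLetter m p a' :: applySubst (phi β m p) v' ++ phi β m p c ∈ Lang β m p :=
    fun a' c hc => Lang.of_infix (Lang.applySubst_mem hc)
      ⟨List.replicate (digit β a') 0, [], by simp [phi_eq β m p a']⟩
  refine hβ.exists_isLexPreimage_of_lift (fun hab => h.1 (by rw [hab])) (by simp [hf]) ?_
    (hlift a') (hlift b') hc hd hφc hφd h
  rw [gL, hf, if_neg (phi_ne_nil a').symm, if_neg (phi_ne_nil b').symm]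
  ext x
  rw [List.length_nil, List.rdrop_zero, List.rdrop_zero]
  simp [phi_eq, eq_comm]

/-- The case where `f_L(a', b') = φ(a')`. -/
theorem exists_isLexPreimage_of_lt (hβ : IsNonSimpleParry β m p)
    (h0 : 1 < digit β 0 ∨ 2 ≤ m) {a a' b' c d e f i : ℕ} {v' r s : List ℕ}
    (hs : succLetter m p a' = succLetter m p b') (hlt : digit β a' < digit β b')
    (hc : a :: a' :: v' ++ [c] ∈ Lang β m p) (hd : b' :: v' ++ [d] ∈ Lang β m p)
    (hφc : phi β m p c = List.replicate i 0 ++ e :: r)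
    (hφd : phi β m p d = List.replicate i 0 ++ f :: s)
    (h : IsLexSplit β m p (succLetter m p a) 0
      (phi β m p a' ++ applySubst (phi β m p) v' ++ List.replicate i 0) e f) :
    v' ≠ [] ∧ ∃ c d, IsLexPreimage β m p (succLetter m p a) 0
      (phi β m p a' ++ applySubst (phi β m p) v' ++ List.replicate i 0) e f a' b' v' c d := by
  have hc' : a' :: v' ++ [c] ∈ Lang β m p := Lang.of_infix hc ⟨[a], [], by simp⟩
  have hac : [a, a'] ∈ Lang β m p := Lang.of_infix hc ⟨[], v' ++ [c], by simp⟩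
  have ha' := hβ.lt_of_mem_of_mem_lang hc' a' (by simp)
  have hb' := hβ.lt_of_mem_of_mem_lang hd b' (by simp)
  have hne : a' ≠ b' := fun hab => absurd hlt (by rw [hab]; exact lt_irrefl _)
  -- Since `a` is the only left extension of `a'`, every right extension of `a'v'` is one of
  -- `aa'v'`; this gives the lift `hliftc` and makes g_L a pair.
  have huniq := hβ.left_letter_unique ha' hb' hs hlt
  have ha0 : a' ≠ 0 := fun h0 => absurd (hβ.digit_le b') (not_le.2 (by rwa [h0] at hlt))
  obtain ⟨n, hn⟩ : ∃ n, digit β b' = n + 1 + digit β a' := ⟨digit β b' - digit β a' - 1, by omega⟩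
  have hφb : phi β m p b' = List.replicate (n + 1) 0 ++ phi β m p a' := by
    rw [phi_eq, phi_eq, hn, hs, ← List.append_assoc, ← List.replicate_add]
  have hf := fL_eq_left hφb
  have hliftc : ∀ c, a' :: v' ++ [c] ∈ Lang β m p → succLetter m p a ::
      (phi β m p a' ++ applySubst (phi β m p) v') ++ phi β m p c ∈ Lang β m p := by
    intro c hc
    obtain ⟨a₁, h1⟩ := hβ.exists_left_extension ha0 hc
    obtain rfl := huniq a a₁ hac (Lang.of_infix h1 ⟨[], v' ++ [c], by simp⟩)
    exact Lang.of_infix (Lang.applySubst_mem h1)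
      ⟨List.replicate (digit β a) 0, [], by simp [phi_eq β m p a]⟩
  have hliftd : ∀ d, b' :: v' ++ [d] ∈ Lang β m p → 0 ::
      (phi β m p a' ++ applySubst (phi β m p) v') ++ phi β m p d ∈ Lang β m p := by
    intro d hd
    refine Lang.of_infix (Lang.applySubst_mem hd) ⟨List.replicate n 0, [], ?_⟩
    simp [hφb, List.replicate_succ']
  -- For empty `v'`, both `a'` and `b'` can be followed by 0, the greatest letter. The two greatest
  -- extensions would agree, forcing `e = f`.
  have hv' : v' ≠ [] := by
    rintro rfl
    obtain ⟨c', h1, r', h2⟩ := hβ.exists_greatest_preimage hliftc hc' hφc h.2.1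
    obtain ⟨d', h3, s', h4⟩ := hβ.exists_greatest_preimage hliftd hd hφd h.2.2.1
    obtain ⟨hz1, hz2⟩ := hβ.pred_zero_mem h0
    have hz : [a', 0] ∈ Lang β m p ∧ [b', 0] ∈ Lang β m p := by
      rcases eq_or_of_succLetter_eq ha' hb' hs with hab | ⟨rfl, rfl⟩ | ⟨rfl, rfl⟩
      · exact absurd hab hne
      · exact ⟨hz1, hz2⟩
      · exact ⟨hz2, hz1⟩
    rw [hβ.eq_zero_of_greatest h1 hz.1] at h2
    rw [hβ.eq_zero_of_greatest h3 hz.2, h2] at h4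
    exact h.2.2.2 (List.cons.inj (List.append_cancel_left h4)).1
  have hg : gL (phi β m p) (uBeta β m p) a' b' = {succLetter m p a, 0} := by
    obtain ⟨y, v', rfl⟩ := List.exists_cons_of_ne_nil hv'
    rw [gL, if_pos hf, gLSuffix, hφb, List.rdrop_append_length]
    ext x
    simp only [Set.mem_union, Set.mem_ofPred_eq, Set.mem_insert_iff, Set.mem_singleton_iff]
    constructor
    · rintro (hx | ⟨a₁, h1, -, h2⟩)
      · right; simpa [List.replicate_succ', eq_comm] using hx
      · left
        obtain rfl := huniq a a₁ hac (hβ.mem_lext_iff.1 h1)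
        simpa [phi_eq, eq_comm] using h2
    -- The first letter `y` of `v'` is the common right extension that the definition of g_L
    -- requires.
    · rintro (rfl | rfl)
      · refine Or.inr ⟨a, hβ.mem_lext_iff.2 hac, ⟨y, ?_, ?_⟩, by simp [phi_eq]⟩
        · exact hβ.mem_rext_iff.2 (Lang.of_infix hc ⟨[], v' ++ [c], by simp⟩)
        · exact hβ.mem_rext_iff.2 (Lang.of_infix hd ⟨[], v' ++ [d], by simp⟩)
      · left; simp [List.replicate_succ']
  exact ⟨hv', hβ.exists_isLexPreimage_of_lift hne (by rw [hf])
    hg hliftc hliftd hc' hd hφc hφd h⟩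

/-- Every word with distinct lexicographically greatest right extensions that contains a nonzero
letter has a nonempty preimage of the same kind. -/
theorem exists_isLexPreimage (hβ : IsNonSimpleParry β m p) (h0 : 1 < digit β 0 ∨ 2 ≤ m)
    {a b e f j x : ℕ} {W : List ℕ} (hx : x ≠ 0)
    (h : IsLexSplit β m p a b (List.replicate j 0 ++ x :: W) e f) :
    ∃ a' b' v' c d, v' ≠ [] ∧
      IsLexPreimage β m p a b (List.replicate j 0 ++ x :: W) e f a' b' v' c d := by
  obtain ⟨y, Y, c, i, r, rfl, rfl, -, h1, h2, h3⟩ :=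
    hβ.exists_desubstitution hx (hβ.mem_lang_of_greatest h.2.1)
  obtain ⟨y', Y', d, i', r', h4, h5, -, h6, h7, h8⟩ :=
    hβ.exists_desubstitution hx (hβ.mem_lang_of_greatest h.2.2.1)
  obtain ⟨rfl, rfl⟩ := hβ.applySubst_append_zeros_inj
    (fun x hx => hβ.lt_of_mem_of_mem_lang h2 x (by simp [hx]))
    (fun x hx => hβ.lt_of_mem_of_mem_lang h7 x (by simp [hx])) h5
  have hy := hβ.lt_of_mem_of_mem_lang h2 y (by simp)
  have hy' := hβ.lt_of_mem_of_mem_lang h7 y' (by simp)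
  have hv : List.replicate (digit β y) 0 ++ succLetter m p y ::
      (applySubst (phi β m p) Y ++ List.replicate i 0) =
      phi β m p y ++ applySubst (phi β m p) Y ++ List.replicate i 0 := by simp [phi_eq]
  have hv' : List.replicate (digit β y') 0 ++ succLetter m p y ::
      (applySubst (phi β m p) Y ++ List.replicate i 0) =
      phi β m p y' ++ applySubst (phi β m p) Y ++ List.replicate i 0 := by simp [phi_eq, h4]
  -- If both left letters lie inside zero blocks, they are equal. If exactly one does, one image is
  -- a proper suffix of the other. If neither does, the first preimage letters coincide and join the
  -- preimage word.
  rcases h3 with ⟨hj, rfl⟩ | ⟨rfl, a', rfl, h3⟩ <;>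
    rcases h8 with ⟨hj', rfl⟩ | ⟨hj', b', rfl, h8⟩
  · exact absurd rfl h.1
  · subst hj'
    rw [hv'] at h ⊢
    obtain ⟨h9, c', d', h10⟩ :=
      hβ.exists_isLexPreimage_of_lt h0 h4.symm hj h8 h2 h6 h1 h.symm
    exact ⟨_, _, _, _, _, h9, h10.swap hβ⟩
  · rw [hv] at h ⊢
    obtain ⟨h9, c', d', h10⟩ := hβ.exists_isLexPreimage_of_lt h0 h4 hj' h3 h7 h1 h6 h
    exact ⟨_, _, _, _, _, h9, h10⟩
  · obtain ⟨rfl, -⟩ := hβ.phi_append_inj hy hy' (x := []) (y := [])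
      (by rw [phi_eq, phi_eq, hj', h4])
    rw [hv, ← applySubst_cons] at h ⊢
    obtain ⟨c', d', h10⟩ := hβ.exists_isLexPreimage_of_eq h3 h8 h1 h6 h
    exact ⟨_, _, _, _, _, by simp, h10⟩

/-- A weight on letters that increases under the substitution. -/
theorem exists_weight (hβ : IsNonSimpleParry β m p) :
    ∃ w : ℕ → ℕ, ∀ c < m + p, w c < digit β c * w 0 + w (succLetter m p c) := by
  classical
  have hex : ∀ x, ∃ j, digit β (x + j) ≠ 0 := fun x => by
    obtain ⟨n, h1, h2⟩ := hβ.not_finite x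
    exact ⟨n - x, by rwa [Nat.add_sub_cancel' h1]⟩
  set h : ℕ → ℕ := fun x => Nat.find (hex x) with hh
  have hspec : ∀ x, digit β (x + h x) ≠ 0 := fun x => Nat.find_spec (hex x)
  have hmin : ∀ x j, digit β (x + j) ≠ 0 → h x ≤ j := fun x j hj => Nat.find_min' (hex x) hj
  have hle : ∀ x < m + p, h x ≤ (Finset.range (m + p)).sup h := fun x hx =>
    Finset.le_sup (Finset.mem_range.2 hx)
  -- The weight falls with the distance `h` to the next nonzero digit. A letter with digit zero
  -- moves one step closer, and any other letter produces a 0, which has the maximal weight.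
  refine ⟨fun x => (Finset.range (m + p)).sup h + 1 - h x, fun c hc => ?_⟩
  have h1 := hle c hc
  have h2 := hle _ (succLetter_lt (m := m) hβ.p_pos c)
  have h3 : h 0 = 0 := Nat.le_zero.1 (hmin 0 0 hβ.digit_zero_pos.ne')
  set K := (Finset.range (m + p)).sup h
  rcases Nat.eq_zero_or_pos (digit β c) with h4 | h4
  · obtain ⟨q, hq⟩ : ∃ q, h c = q + 1 := by
      refine Nat.exists_eq_succ_of_ne_zero fun h5 => hspec c ?_
      rw [h5]; exact h4
    have h5 : h (succLetter m p c) ≤ q := by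
      refine hmin _ _ ?_
      have h6 : digit β (succLetter m p c + q) = digit β (c + 1 + q) :=
        congrFun (toLex.injective (hβ.key_succLetter hc)) q
      have h7 := hspec c
      rwa [hq, add_comm q, ← add_assoc, ← h6] at h7
    simp only [h4, zero_mul, zero_add]
    omega
  · have h5 := Nat.le_mul_of_pos_left (K + 1 - h 0) h4
    change K + 1 - h c < digit β c * (K + 1 - h 0) + (K + 1 - h (succLetter m p c))
    rw [h3] at h5 ⊢
    omega

/-- The measure for the descent. Length would not do, since φ sends a letter with digit zero to a
single letter. -/
theorem exists_wordWeight (hβ : IsNonSimpleParry β m p) :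
    ∃ w : ℕ → ℕ, ∀ v : List ℕ, (∀ x ∈ v, x < m + p) → v ≠ [] →
      (v.map w).sum < ((applySubst (phi β m p) v).map w).sum := by
  obtain ⟨w, hw⟩ := hβ.exists_weight
  refine ⟨w, fun v hv hne => ?_⟩
  have hle : ∀ v : List ℕ, (∀ x ∈ v, x < m + p) →
      (v.map w).sum ≤ ((applySubst (phi β m p) v).map w).sum := by
    intro v hv
    induction v with
    | nil => simp
    | cons c v ih =>
      have h1 := hw c (hv c (by simp))
      have h2 := ih fun x hx => hv x (by simp [hx])
      simp [phi_eq]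
      omega
  cases v with
  | nil => exact absurd rfl hne
  | cons c v =>
    have h1 := hw c (hv c (by simp))
    have h2 := hle v fun x hx => hv x (by simp [hx])
    simp [phi_eq]
    omega

end IsNonSimpleParry

end Preimage

end ParryWord

namespace ParryWord

/-! ### Descent to words of zeros and identification of the generator. -/

section Generation

variable {β : ℝ} {m p : ℕ}

theorem exists_eq_replicate_or_eq_replicate_append_cons (v : List ℕ) :
    (∃ i, v = List.replicate i 0) ∨ ∃ j x W, x ≠ 0 ∧ v = List.replicate j 0 ++ x :: W := by
  induction v with
  | nil => exact Or.inl ⟨0, rfl⟩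
  | cons y v ih =>
    by_cases hy : y = 0
    · subst hy
      rcases ih with ⟨i, rfl⟩ | ⟨j, x, W, hx, rfl⟩
      · exact Or.inl ⟨i + 1, rfl⟩
      · exact Or.inr ⟨j + 1, x, W, hx, rfl⟩
    · exact Or.inr ⟨0, y, v, hy, rfl⟩

namespace IsNonSimpleParry

/-- Greatest extensions have greatest first digits, which gives the min–max condition; `e ≠ f` cuts
f_R at exactly the i zeros. -/
theorem isMaxFImage_of_isLexPreimage {a b a' b' c d e f : ℕ} {v v' : List ℕ} (hef : e ≠ f)
    (h : IsLexPreimage β m p a b v e f a' b' v' c d) : IsMaxFImage β m p a' b' v' v := by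
  obtain ⟨⟨-, h1, h2, h3⟩, -, i, r, s, h4, h5, h6⟩ := h
  refine ⟨c, h1.1, d, h2.1, h3, fun e he f hf _ => ⟨?_, ?_⟩, ?_⟩
  · exact (min_le_left _ _).trans (digit_le_of_key_le (h1.2 e he))
  · exact (min_le_right _ _).trans (digit_le_of_key_le (h2.2 f hf))
  · rw [h4, fR, h5, h6, lcp_append_append, lcp_cons_of_ne hef, List.append_nil]

/-- Descent along lexicographic preimages down to a word of zeros. -/
theorem isGeneratedBy_of_isLexSplit (hβ : IsNonSimpleParry β m p)
    (h0 : 1 < digit β 0 ∨ 2 ≤ m) {g : List ℕ}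
    (hbase : ∀ i a b e f, IsLexSplit β m p a b (List.replicate i 0) e f →
      List.replicate i 0 ≠ [] → List.replicate i 0 = g)
    {a b e f : ℕ} {v : List ℕ} (hv : v ≠ []) (h : IsLexSplit β m p a b v e f) :
    IsGeneratedBy β m p g a b v := by
  obtain ⟨w, hw⟩ := hβ.exists_wordWeight
  -- The induction records the common prefix L together with the letters `e`, `f` after it. Knowing
  -- these, one more application of φ lengthens the prefix to φ(L) followed by i zeros.
  suffices H : ∀ n v a b e f, (v.map w).sum = n → v ≠ [] → IsLexSplit β m p a b v e f →
      ∃ k a₀ b₀ s c d L x y, a₀ ≠ b₀ ∧ a₀ ∈ lext (uBeta β m p) g ∧ b₀ ∈ lext (uBeta β m p) g ∧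
        IsIterMaxFImage β m p a₀ b₀ g k a b v ∧ IsIterPrefix β m p a₀ b₀ k a b s ∧
        IsLexGreatestRext β m p (a₀ :: g) c ∧ IsLexGreatestRext β m p (b₀ :: g) d ∧ c ≠ d ∧
        phiIter β m p k [c] = L ++ e :: x ∧ phiIter β m p k [d] = L ++ f :: y ∧
        v = s ++ phiIter β m p k g ++ L by
    obtain ⟨k, a₀, b₀, s, c, d, L, x, y, h1, h2, h3, h4, h5, h6, h7, h8, h9, h10, h11⟩ :=
      H _ v a b e f rfl hv h
    refine ⟨k, a₀, b₀, h1, h2, h3, h4, s, c, d, h5, h6, h7, h8, ?_⟩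
    rw [h9, h10, lcp_append_append, lcp_cons_of_ne h.2.2.2, List.append_nil, h11]
  intro n
  induction n using Nat.strong_induction_on with
  | _ n ih =>
  rintro v a b e f rfl hv h
  rcases exists_eq_replicate_or_eq_replicate_append_cons v with ⟨i, rfl⟩ | ⟨j, x, W, hx, rfl⟩
  · have hg := hbase i a b e f h hv
    rw [hg] at h ⊢
    have hext : ∀ {a e}, IsLexGreatestRext β m p (a :: g) e → a ∈ lext (uBeta β m p) g :=
      fun ha => hβ.mem_lext_iff.2
        (Lang.of_infix (hβ.mem_lang_of_greatest ha) (List.prefix_append _ _).isInfix)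
    exact ⟨0, a, b, [], e, f, [], [], [], h.1, hext h.2.1, hext h.2.2.1, .zero, .zero, h.2.1,
      h.2.2.1, h.2.2.2, rfl, rfl, by simp [phiIter]⟩
  · obtain ⟨a', b', v', c', d', hv', hpre⟩ := hβ.exists_isLexPreimage h0 hx h
    have hmax := isMaxFImage_of_isLexPreimage h.2.2.2 hpre
    obtain ⟨hsplit, hg, i, r, r', h1, h2, h3⟩ := hpre
    have hlt : (v'.map w).sum < ((List.replicate j 0 ++ x :: W).map w).sum := by
      refine (hw v' (fun y hy => hβ.lt_of_greatest hsplit.2.1 y (by simp [hy])) hv').trans_le ?_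
      rw [h1, List.map_append, List.map_append, List.sum_append, List.sum_append]
      omega
    obtain ⟨k, a₀, b₀, s, c, d, L, y, y', g1, g2, g3, g4, g5, g6, g7, g8, g9, g10, g11⟩ :=
      ih _ hlt v' a' b' c' d' rfl hv' hsplit
    refine ⟨k + 1, a₀, b₀, _, c, d, applySubst (phi β m p) L ++ List.replicate i 0,
      r ++ applySubst (phi β m p) y, r' ++ applySubst (phi β m p) y', g1, g2, g3,
      .succ g4 hg hmax, .succ g5 hg, g6, g7, g8, ?_, ?_, ?_⟩
    · simp [phiIter_succ, g9, h2]
    · simp [phiIter_succ, g10, h3]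
    · rw [h1, g11]; simp [phiIter_succ]

theorem isLexSplit_of_isMaximalLS (hβ : IsNonSimpleParry β m p) {a b : ℕ} {v : List ℕ}
    (h : IsMaximalLS (uBeta β m p) a b v) : ∃ e f, IsLexSplit β m p a b v e f := by
  obtain ⟨hab, ha, hb, hdisj⟩ := h
  obtain ⟨e, he⟩ := hβ.exists_isLexGreatestRext (hβ.mem_lext_iff.1 ha)
  obtain ⟨f, hf⟩ := hβ.exists_isLexGreatestRext (hβ.mem_lext_iff.1 hb)
  refine ⟨e, f, hab, he, hf, ?_⟩
  rintro rfl
  exact Set.eq_empty_iff_forall_notMem.1 hdisj e ⟨he.1, hf.1⟩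

/-! The words of zeros with distinct lexicographically greatest right extensions. -/

theorem cons_phi_zero_mem (hβ : IsNonSimpleParry β m p) (h : 1 < digit β 0) {a : ℕ} (ha : a ≠ 0)
    (ha' : a < m + p) : a :: phi β m p 0 ∈ Lang β m p := by
  have h1 := Lang.applySubst_mem
    (hβ.append_zero_mem_of_le (zero_zero_mem h) (Nat.zero_le (a - 1)) (by omega))
  refine Lang.of_infix h1 ⟨List.replicate (digit β (a - 1)) 0, [], ?_⟩
  have h2 : succLetter m p (a - 1) = a := by rw [succLetter_of_lt] <;> omega
  simp [phi_eq β m p (a - 1), h2]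

/-- Whether or not `a` is 0, the word `a0^i` can be extended by 0. The bound is what lets the run of
i + 2 zeros, in the case `a = 0`, fit inside φ(0). -/
theorem zero_greatest_of_lt (hβ : IsNonSimpleParry β m p) {a e i : ℕ}
    (h : IsLexGreatestRext β m p (a :: List.replicate i 0) e) (hi : i + 1 < digit β 0) :
    e = 0 := by
  refine hβ.eq_zero_of_greatest h ?_
  obtain ⟨n, hn⟩ : ∃ n, digit β 0 = i + 1 + (n + 1) := ⟨digit β 0 - i - 2, by omega⟩
  rcases eq_or_ne a 0 with rfl | ha
  · refine Lang.of_infix phi_zero_mem ⟨[], List.replicate n 0 ++ [succLetter m p 0], ?_⟩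
    rw [phi_eq, hn, List.replicate_add (i + 1), ← List.replicate_succ, List.replicate_succ (n := n)]
    simp
  · refine Lang.of_infix (hβ.cons_phi_zero_mem (by omega) ha (hβ.lt_of_greatest h a (by simp)))
      ⟨[], List.replicate (n + 1) 0 ++ [succLetter m p 0], ?_⟩
    rw [phi_eq, hn, List.replicate_add (i + 1), List.replicate_succ' (n := i)]
    simp

/-- The zeros fill the whole block of some φ(y) with maximal digit, so `e` ends φ(y) and its tail is
that of `y + 1`, at most that of 1. The letter 1 does occur, at the end of φ(0). -/
theorem one_greatest (hβ : IsNonSimpleParry β m p) (h1 : 1 < digit β 0) {a e : ℕ}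
    (h : IsLexGreatestRext β m p (a :: List.replicate (digit β 0) 0) e) : e = 1 := by
  have hmem := hβ.mem_lang_of_greatest h
  have hm := hβ.m_pos
  have hp := hβ.p_pos
  have ha : a ≠ 0 := by
    rintro rfl
    have := hβ.le_digit_zero_of_replicate_mem
      (Lang.of_infix hmem (v := List.replicate (digit β 0 + 1) 0)
        (by rw [List.replicate_succ]; exact (List.prefix_append _ _).isInfix))
    omega
  have he : e ≠ 0 := by
    rintro rfl
    have := hβ.le_digit_zero_of_replicate_mem
      (Lang.of_infix hmem (v := List.replicate (digit β 0 + 1) 0)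
        ⟨[a], [], by rw [List.replicate_succ']; simp⟩)
    omega
  obtain ⟨e', he'⟩ := hβ.exists_right_extension hmem
  obtain ⟨y, Y, c, i, r, h2, -, -, -, h3, h4⟩ :=
    hβ.exists_desubstitution (a := a) (j := digit β 0) (W := []) he (by simpa using he')
  have hy : digit β y = digit β 0 := by
    have := hβ.digit_le y
    rcases h4 with ⟨h4, -⟩ | ⟨h4, -⟩ <;> omega
  refine hβ.eq_of_greatest h ?_ ?_
  · have := hβ.cons_phi_zero_mem h1 ha (hβ.lt_of_greatest h a (by simp))
    rwa [phi_eq, succLetter_of_lt (by omega)] at this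
  · rw [h2, hβ.key_succLetter (hβ.lt_of_mem_of_mem_lang h3 y (by simp))]
    exact key_succ_le_of_key_le (key_le_key_zero hβ.one_lt y) hy

theorem le_digit_zero_of_isLexSplit_replicate (hβ : IsNonSimpleParry β m p) {a b e f i : ℕ}
    (h : IsLexSplit β m p a b (List.replicate i 0) e f) : i ≤ digit β 0 :=
  hβ.le_digit_zero_of_replicate_mem (Lang.of_infix (hβ.mem_lang_of_greatest h.2.1)
    ⟨[a], [e], by simp⟩)

theorem eq_of_isLexSplit_replicate (hβ : IsNonSimpleParry β m p) (h1 : 1 < digit β 0)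
    {a b e f i : ℕ} (h : IsLexSplit β m p a b (List.replicate i 0) e f) : i = digit β 0 - 1 := by
  have hi := hβ.le_digit_zero_of_isLexSplit_replicate h
  by_contra hne
  rcases hi.lt_or_eq with hi | rfl
  · exact h.2.2.2 ((hβ.zero_greatest_of_lt h.2.1 (by omega)).trans
      (hβ.zero_greatest_of_lt h.2.2.1 (by omega)).symm)
  · exact h.2.2.2 ((hβ.one_greatest h1 h.2.1).trans (hβ.one_greatest h1 h.2.2.1).symm)

end IsNonSimpleParry

end Generation

end ParryWord

theorem mainTheorem5 (β : ℝ) (m p : ℕ) (hβ : ParryWord.IsNonSimpleParry β m p)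
    (a b : ℕ) (v : List ℕ) (hv : ParryWord.IsMaximalLS (ParryWord.uBeta β m p) a b v) :
    (1 < ParryWord.digit β 0 →
      ParryWord.IsGeneratedBy β m p (List.replicate (ParryWord.digit β 0 - 1) 0) a b v) ∧
    (ParryWord.digit β 0 = 1 → 2 ≤ m → v ≠ [] →
      ParryWord.IsGeneratedBy β m p [0] a b v) := by
  obtain ⟨e, f, h⟩ := hβ.isLexSplit_of_isMaximalLS hv
  refine ⟨fun h1 => ?_, fun h1 hm hne => ?_⟩
  -- The empty word is the zero run of length 0, and 0 differs from t₁ - 1.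
  · have hne : v ≠ [] := by
      rintro rfl
      have := hβ.eq_of_isLexSplit_replicate h1 (i := 0) h
      omega
    refine hβ.isGeneratedBy_of_isLexSplit (Or.inl h1) (fun i a b e f h _ => ?_) hne h
    rw [hβ.eq_of_isLexSplit_replicate h1 h]
  · refine hβ.isGeneratedBy_of_isLexSplit (Or.inr hm) (fun i a b e f h hi => ?_) hne h
    have h2 := hβ.le_digit_zero_of_isLexSplit_replicate h
    -- With t₁ = 1, runs of zeros have length at most 1.
    rcases i with - | i
    · exact absurd rfl hi
    · obtain rfl : i = 0 := by omega
      rfl
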